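/- Let $K$ be a number field with ring of integers $\mathcal O_K$, real embeddings $\sigma_1,\dots,\sigma_s$ and complex embeddings $\tau_1,\dots,\tau_t$ (one chosen from each pair of complex conjugate embeddings); let $\Sigma=\{\sigma_1,\dots,\sigma_s,\tau_1,\dots,\tau_t\}$ and $\iota:K\to\mathbb R^s\times\mathbb C^t$, $\iota(\gamma)=(\rho(\gamma))_{\rho\in\Sigma}$. Let $\lambda$ be Lebesgue measure on $\mathbb R^s\times\mathbb C^t$ and let $D_K$ be a (measurable) fundamental domain for the lattice $\iota(\mathcal O_K)$. Let $I_K$ be the set of nonzero ideals of $\mathcal O_K$; for $\mathfrak n\in I_K$ put $\mathrm N(\mathfrak n)=\#(\mathcal O_K/\mathfrak n)$ and $\Phi(\mathfrak n)=\#(\mathcal O_K/\mathfrak n)^\times$. For $\gamma\in K$ let $\operatorname{den}(\gamma)\in I_K$ be the ideal $\mathfrak n$ in the unique expression $(\gamma)=\mathfrak a/\mathfrak n$ with $\mathfrak a,\mathfrak n$ coprime ideals of $\mathcal O_K$ (so $\operatorname{den}(0)=\mathcal O_K$). For each $\rho\in\Sigma$ let $\psi_\rho:I_K\to\mathbb R_{\ge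 0}$ be a function, and put $$\Psi(\mathfrak n)=\prod_{\sigma\in\Sigma\text{ real}}\psi_\sigma(\mathfrak n)\cdot\prod_{\tau\in\Sigma\text{ complex}}\psi_\tau(\mathfrak n)^2 .$$ Suppose that $$\sum_{\mathfrak n\in I_K}\Phi(\mathfrak n)\Psi(\mathfrak n)=\infty,\qquad \limsup_{R\to\infty}\frac{\sum_{\mathrm N(\mathfrak n)\le R}\Phi(\mathfrak n)\Psi(\mathfrak n)}{\sum_{\mathrm N(\mathfrak n)\le R}\mathrm N(\mathfrak n)\Psi(\mathfrak n)}>0,$$ and that $$\psi_\rho(\mathfrak n)\le\frac{1}{2\,\mathrm N(\mathfrak n)^{1/(s+t)}}\qquad\text{for all }\rho\in\Sigma,\ \mathfrak n\in I_K .$$ Then the set of $x\in D_K$ for which there are infinitely many $\gamma\in K$ with $$|x_\rho-\rho(\gamma)|\le\psi_\rho(\operatorname{den}(\gamma))\quad\text{for all }\rho\in\Sigma ,$$ where $|\cdot|$ is the usual absolute value on $\mathbb R$ and on $\mathbb C$, is $\lambda$-measurable and has measure $\lambda(D_K)$. (Since $\psi_\rho\le\tfrac12$, the same then holds a fortiori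 if $|\cdot|$ is replaced by its square at the complex embeddings.) -/

import Mathlib

open scoped NNReal ENNReal nonZeroDivisors NumberField
open NumberField NumberField.InfinitePlace

noncomputable section

namespace DuffinSchaeffer

variable (K : Type*) [Field K] [NumberField K]

/-- The semigroup `I_K` of nonzero integral ideals of `K`. -/
abbrev IntIdeal : Type _ := (Ideal (𝓞 K))⁰

variable {K}

/-- The absolute norm `N(𝔫)`. -/
def idealNorm (n : IntIdeal K) : ℕ := Ideal.absNorm (n : Ideal (𝓞 K))

/-- The Euler function `Φ(𝔫) = #(𝓞_K / 𝔫)ˣ`. -/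
def eulerPhi (n : IntIdeal K) : ℕ := Nat.card (𝓞 K ⧸ (n : Ideal (𝓞 K)))ˣ

open scoped Classical in
/-- `Ψ(𝔫) = ∏_{σ real} ψ_σ(𝔫) · ∏_{τ complex} ψ_τ(𝔫)²`; one embedding is taken from each pair of
complex conjugate embeddings, so the embeddings correspond to the infinite places. -/
def bigPsi (ψ : InfinitePlace K → IntIdeal K → ℝ≥0) (n : IntIdeal K) : ℝ≥0 :=
  (∏ σ : {w : InfinitePlace K // IsReal w}, ψ σ.1 n) *
    ∏ τ : {w : InfinitePlace K // IsComplex w}, ψ τ.1 n ^ 2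

variable (K) in
theorem finite_idealNorm_le (R : ℕ) : {n : IntIdeal K | idealNorm n ≤ R}.Finite :=
  (Ideal.finite_setOfPred_absNorm_le (S := 𝓞 K) R).preimage Subtype.val_injective.injOn

variable (K) in
/-- The finite set of nonzero integral ideals of norm at most `R`. -/
def idealsUpTo (R : ℕ) : Finset (IntIdeal K) := (finite_idealNorm_le K R).toFinset

/-- `(γ) = 𝔞 / 𝔫` with `𝔞`, `𝔫` coprime integral ideals. (For `γ = 0` this forces `𝔞 = 0` and
`𝔫 = (1)`.) -/
def IsReducedForm (γ : K) (a : Ideal (𝓞 K)) (n : IntIdeal K) : Prop :=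
  IsCoprime a (n : Ideal (𝓞 K)) ∧
    FractionalIdeal.spanSingleton (𝓞 K)⁰ γ =
      (a : FractionalIdeal (𝓞 K)⁰ K) / ((n : Ideal (𝓞 K)) : FractionalIdeal (𝓞 K)⁰ K)

theorem coe_intIdeal_ne_zero (n : IntIdeal K) :
    ((n : Ideal (𝓞 K)) : FractionalIdeal (𝓞 K)⁰ K) ≠ 0 := by
  rw [Ne, FractionalIdeal.coeIdeal_eq_zero]
  exact nonZeroDivisors.coe_ne_zero n

theorem exists_isReducedForm (γ : K) : ∃ n : IntIdeal K, ∃ a, IsReducedForm γ a n := by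
  obtain ⟨p, q, hq, rfl⟩ := IsFractionRing.div_surjective (A := 𝓞 K) γ
  have hq0 : q ≠ 0 := nonZeroDivisors.ne_zero hq
  set g : Ideal (𝓞 K) := Ideal.span {p} ⊔ Ideal.span {q} with hg
  have hgp : g ∣ Ideal.span {p} := Ideal.dvd_iff_le.2 le_sup_left
  have hgq : g ∣ Ideal.span {q} := Ideal.dvd_iff_le.2 le_sup_right
  obtain ⟨a, ha⟩ := hgp
  obtain ⟨n, hn⟩ := hgq
  have hgn : g * n ≠ 0 := by
    rw [← hn]; simpa [Ideal.zero_eq_bot] using hq0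
  have hg0 : g ≠ 0 := left_ne_zero_of_mul hgn
  have hn0 : n ≠ 0 := right_ne_zero_of_mul hgn
  refine ⟨⟨n, mem_nonZeroDivisors_of_ne_zero hn0⟩, a, ?_, ?_⟩
  · rw [Ideal.isCoprime_iff_sup_eq]
    have h : g * (a ⊔ n) = g * ⊤ := by
      rw [Ideal.mul_sup, ← ha, ← hn, Ideal.mul_top]
    exact mul_left_cancel₀ hg0 h
  · have hnK : (n : FractionalIdeal (𝓞 K)⁰ K) ≠ 0 := by
      rwa [Ne, FractionalIdeal.coeIdeal_eq_zero]
    have hgK : (g : FractionalIdeal (𝓞 K)⁰ K) ≠ 0 := by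
      rwa [Ne, FractionalIdeal.coeIdeal_eq_zero]
    have hqK : algebraMap (𝓞 K) K q ≠ 0 := by simpa using hq0
    have e1 : FractionalIdeal.spanSingleton (𝓞 K)⁰ (algebraMap (𝓞 K) K p) =
        (g : FractionalIdeal (𝓞 K)⁰ K) * a := by
      rw [← FractionalIdeal.coeIdeal_mul, ← ha, FractionalIdeal.coeIdeal_span_singleton]
    have e2 : FractionalIdeal.spanSingleton (𝓞 K)⁰ (algebraMap (𝓞 K) K q) =
        (g : FractionalIdeal (𝓞 K)⁰ K) * n := by
      rw [← FractionalIdeal.coeIdeal_mul, ← hn, FractionalIdeal.coeIdeal_span_singleton]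
    have e3 : FractionalIdeal.spanSingleton (𝓞 K)⁰
        (algebraMap (𝓞 K) K p / algebraMap (𝓞 K) K q) *
        FractionalIdeal.spanSingleton (𝓞 K)⁰ (algebraMap (𝓞 K) K q) =
        FractionalIdeal.spanSingleton (𝓞 K)⁰ (algebraMap (𝓞 K) K p) := by
      rw [FractionalIdeal.spanSingleton_mul_spanSingleton, div_mul_cancel₀ _ hqK]
    rw [eq_div_iff hnK]
    rw [e1, e2] at e3
    apply mul_left_cancel₀ hgK
    rw [← e3]; ring

theorem IsReducedForm.unique {γ : K} {a b : Ideal (𝓞 K)} {m n : IntIdeal K}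
    (h : IsReducedForm γ a m) (h' : IsReducedForm γ b n) : a = b ∧ m = n := by
  have e := h.2.symm.trans h'.2
  rw [div_eq_div_iff (coe_intIdeal_ne_zero m) (coe_intIdeal_ne_zero n),
    ← FractionalIdeal.coeIdeal_mul, ← FractionalIdeal.coeIdeal_mul,
    FractionalIdeal.coeIdeal_inj] at e
  have hnm : (n : Ideal (𝓞 K)) ∣ m :=
    h'.1.symm.dvd_of_dvd_mul_left (e ▸ Dvd.intro_left a rfl)
  have hmn : (m : Ideal (𝓞 K)) ∣ n :=
    h.1.symm.dvd_of_dvd_mul_left (e.symm ▸ Dvd.intro_left b rfl)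
  have hmn' : m = n := Subtype.ext (dvd_antisymm hmn hnm)
  subst hmn'
  exact ⟨mul_right_cancel₀ (nonZeroDivisors.coe_ne_zero m) e, rfl⟩

/-- `den γ`: the ideal `𝔫` in the unique expression `(γ) = 𝔞 / 𝔫` with `𝔞`, `𝔫` coprime. -/
def den (γ : K) : IntIdeal K := (exists_isReducedForm γ).choose

theorem den_spec (γ : K) : ∃ a, IsReducedForm γ a (den γ) := (exists_isReducedForm γ).choose_spec

/-- `γ` is a good approximation to `x ∈ ℝ^s × ℂ^t`: `|x_ρ - ρ(γ)| ≤ ψ_ρ(den γ)` for each real and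
each complex `ρ`, with the usual absolute values of `ℝ` and `ℂ`. -/
def IsGoodApprox (ψ : InfinitePlace K → IntIdeal K → ℝ≥0) (x : mixedEmbedding.mixedSpace K)
    (γ : K) : Prop :=
  (∀ σ : {w : InfinitePlace K // IsReal w},
    |x.1 σ - (mixedEmbedding K γ).1 σ| ≤ (ψ σ.1 (den γ) : ℝ)) ∧
  (∀ τ : {w : InfinitePlace K // IsComplex w},
    ‖x.2 τ - (mixedEmbedding K γ).2 τ‖ ≤ (ψ τ.1 (den γ) : ℝ))

/-- The set of `x ∈ D` that have infinitely many good approximations in `K`. -/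
def approxSet (D : Set (mixedEmbedding.mixedSpace K))
    (ψ : InfinitePlace K → IntIdeal K → ℝ≥0) : Set (mixedEmbedding.mixedSpace K) :=
  {x ∈ D | {γ : K | IsGoodApprox ψ x γ}.Infinite}

end DuffinSchaeffer

end

/-!
The proof is a variance argument in which the passage from positive to full measure needs no
zero-one law. Write `V = ℝ^s × ℂ^t`, let `T` be the torus `V / 𝓞 K`, and for `R ∈ ℕ` let `X_R(x)`
be the number of `γ ∈ K` with `N(den γ) ≤ R` such that `x` lies in the open box of half-sides
`ψ(den γ)` centred at `γ`. This function lives on `T`, its integral is a constant times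
`∑_{N(𝔫) ≤ R} Φ(𝔫) Ψ(𝔫)`, and a point with `X_R(x) → ∞` has infinitely many good approximations.

* Second moment. Two elements of denominators `𝔫` and `𝔪` differ by an element of `(𝔫 ∩ 𝔪)⁻¹`, in
  which every nonzero element has norm at least `1 / N(𝔫 ∩ 𝔪)`. A packing argument therefore bounds
  the number of nonzero differences in a box of any shape (`tsum_inverseInBox_le`), every difference
  has at most `N(𝔫 + 𝔪)` representations (`card_representations_le`), and
  `N(𝔫 + 𝔪) N(𝔫 ∩ 𝔪) = N(𝔫) N(𝔪)`. It follows that `∫ X_R² ≪ ∑ Φ Ψ + (∑ N Ψ)²`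
  (`lintegral_hitsUpTo_sq_le`), so that along the values of `R` supplied by the hypothesis on the
  limit superior the normalized functions `X_R / ∫ X_R` stay bounded in `L²(T)`.
* Fourier coefficients. The coefficient of `X_R` at a nonzero frequency is a sum of Ramanujan sums.
  By `norm_ramanujan_sq_le` a Ramanujan sum is `O(N(𝔫)^{1/2})`, hence the coefficient is
  `o(∑ N Ψ)`, that is `o(∫ X_R)` along the same values of `R`.

Consequently `X_R / ∫ X_R` converges weakly in `L²(T)` to a constant function. On the set of points
where `X_R` remains below a fixed bound it converges uniformly to `0`, so this set is null
(`measure_eq_zero_of_tendsto`, `volume_bounded_hits_eq_zero`).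
-/

namespace DuffinSchaeffer

variable {K : Type*} [Field K] [NumberField K]

/-! ### Denominators and the torsion module `K / 𝓞 K` -/

omit [NumberField K] in
theorem coe_int_mul (a b : 𝓞 K) : ((a * b : 𝓞 K) : K) = a * b := rfl

omit [NumberField K] in
theorem coe_int_sub (a b : 𝓞 K) : ((a - b : 𝓞 K) : K) = a - b := rfl

omit [NumberField K] in
theorem coe_int_neg (a : 𝓞 K) : ((-a : 𝓞 K) : K) = -a := rfl

omit [NumberField K] in
theorem isIntegral_coe (a : 𝓞 K) : IsIntegral ℤ (a : K) := a.isIntegral_coe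

omit [NumberField K] in
theorem exists_coe_eq {x : K} (hx : IsIntegral ℤ x) : ∃ o : 𝓞 K, (o : K) = x := ⟨⟨x, hx⟩, rfl⟩

theorem spanSingleton_le_one_iff (x : K) :
    FractionalIdeal.spanSingleton (𝓞 K)⁰ x ≤ 1 ↔ IsIntegral ℤ x := by
  rw [FractionalIdeal.spanSingleton_le_iff_mem, FractionalIdeal.mem_one_iff]
  constructor
  · rintro ⟨o, rfl⟩
    exact isIntegral_coe o
  · intro h
    exact ⟨⟨x, h⟩, rfl⟩

/-- The denominator of `γ` is the annihilator of the class of `γ` in `K / 𝓞 K`. -/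
theorem mem_den_iff (γ : K) (a : 𝓞 K) :
    a ∈ (den γ : Ideal (𝓞 K)) ↔ IsIntegral ℤ ((a : K) * γ) := by
  obtain ⟨b, hco, h⟩ := den_spec γ
  have hn := coe_intIdeal_ne_zero (den γ)
  rw [eq_div_iff hn] at h
  rw [← spanSingleton_le_one_iff, ← Ideal.dvd_span_singleton]
  have e : FractionalIdeal.spanSingleton (𝓞 K)⁰ ((a : K) * γ) *
      ((den γ : Ideal (𝓞 K)) : FractionalIdeal (𝓞 K)⁰ K) =
      ((Ideal.span {a} * b : Ideal (𝓞 K)) : FractionalIdeal (𝓞 K)⁰ K) := by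
    rw [← FractionalIdeal.spanSingleton_mul_spanSingleton, mul_assoc, h,
      FractionalIdeal.coeIdeal_mul, FractionalIdeal.coeIdeal_span_singleton]
  have h1 : (den γ : Ideal (𝓞 K)) ∣ Ideal.span {a} ↔
      (den γ : Ideal (𝓞 K)) ∣ Ideal.span {a} * b :=
    ⟨fun h => h.mul_right _, fun h => hco.symm.dvd_of_dvd_mul_right h⟩
  rw [h1, Ideal.dvd_iff_le, ← FractionalIdeal.coeIdeal_le_coeIdeal K, ← e]
  constructor
  · intro h2
    have h3 := mul_le_mul_left h2 (((den γ : Ideal (𝓞 K)) : FractionalIdeal (𝓞 K)⁰ K)⁻¹)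
    rwa [mul_assoc, mul_inv_cancel₀ hn, mul_one] at h3
  · intro h2
    have h3 := mul_le_mul_left h2 ((den γ : Ideal (𝓞 K)) : FractionalIdeal (𝓞 K)⁰ K)
    rwa [one_mul] at h3

/-- The module `𝔫⁻¹ / 𝓞 K` is cyclic: it has a generator, whose annihilator is `𝔫`. -/
theorem exists_generator (n : IntIdeal K) :
    ∃ g : K, (∀ w : 𝓞 K, IsIntegral ℤ ((w : K) * g) ↔ w ∈ (n : Ideal (𝓞 K))) ∧
      ∀ x : K, (∀ a ∈ (n : Ideal (𝓞 K)), IsIntegral ℤ ((a : K) * x)) →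
        ∃ v : 𝓞 K, IsIntegral ℤ (x - v * g) := by
  -- write `(q) = 𝔫 𝔪` and `𝔪 = (q) + (a)`; the quotient `a / q` is a generator
  obtain ⟨q, hqn, hq0⟩ := Submodule.exists_mem_ne_zero_of_ne_bot
    (nonZeroDivisors.coe_ne_zero n : (n : Ideal (𝓞 K)) ≠ ⊥)
  have hqK : (q : K) ≠ 0 := by simpa using hq0
  obtain ⟨m, hm⟩ := Ideal.dvd_span_singleton.2 hqn
  have hspan : Ideal.span {q} ≠ 0 := by simpa [Ideal.zero_eq_bot] using hq0
  have hm0 : m ≠ 0 := right_ne_zero_of_mul (hm ▸ hspan)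
  have hn0 : (n : Ideal (𝓞 K)) ≠ 0 := nonZeroDivisors.coe_ne_zero n
  have hqm : Ideal.span {q} ≤ m := by
    rw [hm]; exact Ideal.mul_le_right
  obtain ⟨a, ha⟩ := IsDedekindDomain.exists_sup_span_eq hqm hspan
  have ham : a ∈ m := ha ▸ Ideal.mem_sup_right (Ideal.mem_span_singleton_self a)
  refine ⟨a / q, fun w => ⟨fun hw => ?_, fun hw => ?_⟩, fun x hx => ?_⟩
  · have hwa : w * a ∈ Ideal.span {q} := by
      obtain ⟨o, ho⟩ := exists_coe_eq hw
      refine Ideal.mem_span_singleton'.2 ⟨o, RingOfIntegers.coe_injective ?_⟩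
      change (o : K) * q = w * a
      rw [ho]
      field_simp
    have h1 : Ideal.span {w} * m ≤ Ideal.span {q} := by
      rw [← ha, Ideal.mul_sup, Ideal.span_singleton_mul_span_singleton w a]
      exact sup_le Ideal.mul_le_right ((Ideal.span_singleton_le_iff_mem _).2 hwa)
    rw [hm] at h1
    rw [← Ideal.dvd_span_singleton]
    rw [← Ideal.dvd_iff_le] at h1
    exact (mul_dvd_mul_iff_right hm0).1 h1
  · have h1 : w * a ∈ Ideal.span {q} := hm ▸ Ideal.mul_mem_mul hw ham
    obtain ⟨o, ho⟩ := Ideal.mem_span_singleton'.1 h1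
    have h2 : (w : K) * (a / q) = o := by
      rw [← mul_div_assoc, div_eq_iff hqK]
      simpa using (congrArg (algebraMap (𝓞 K) K) ho).symm
    rw [h2]
    exact isIntegral_coe o
  · obtain ⟨y, hyK⟩ := exists_coe_eq (hx q hqn)
    have h1 : Ideal.span {y} * n ≤ m * n := by
      rw [mul_comm m, ← hm, Ideal.mul_le]
      intro r hr s hs
      obtain ⟨t, rfl⟩ := Ideal.mem_span_singleton'.1 hr
      obtain ⟨o, ho⟩ := exists_coe_eq (hx s hs)
      refine Ideal.mem_span_singleton'.2 ⟨t * o, RingOfIntegers.coe_injective ?_⟩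
      change (t : K) * o * q = t * y * s
      rw [hyK, ho]
      ring
    rw [← Ideal.dvd_iff_le, mul_dvd_mul_iff_right hn0, Ideal.dvd_span_singleton, ← ha] at h1
    obtain ⟨r, hr, s, hs, hrs⟩ := Submodule.mem_sup.1 h1
    obtain ⟨r', rfl⟩ := Ideal.mem_span_singleton'.1 hr
    obtain ⟨v, rfl⟩ := Ideal.mem_span_singleton'.1 hs
    refine ⟨v, ?_⟩
    have h2 : x - v * (a / q) = r' := by
      have h3 : (r' : K) * q + v * a = q * x := hyK ▸ congrArg (algebraMap (𝓞 K) K) hrs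
      field_simp
      linear_combination -h3
    rw [h2]
    exact isIntegral_coe r'

variable (K) in
theorem countable_numberField : Countable K :=
  (Module.finBasis ℚ K).equivFun.toEquiv.injective.countable

theorem countable_intIdeal : Countable (IntIdeal K) := by
  have : (⋃ R : ℕ, {n : IntIdeal K | idealNorm n ≤ R}) = Set.univ :=
    Set.eq_univ_of_forall fun n => Set.mem_iUnion.2 ⟨idealNorm n, le_refl (idealNorm n)⟩
  rw [← Set.countable_univ_iff, ← this]
  exact Set.countable_iUnion fun R => (finite_idealNorm_le K R).countable

theorem idealNorm_ne_zero (n : IntIdeal K) : idealNorm n ≠ 0 :=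
  Ideal.absNorm_ne_zero_of_nonZeroDivisors n

instance finite_quotient (n : IntIdeal K) : Finite (𝓞 K ⧸ (n : Ideal (𝓞 K))) :=
  Ideal.finiteQuotientOfFreeOfNeBot _ (nonZeroDivisors.coe_ne_zero n)

theorem card_quotient (n : IntIdeal K) :
    Nat.card (𝓞 K ⧸ (n : Ideal (𝓞 K))) = idealNorm n :=
  (Submodule.cardQuot_apply _).symm.trans (Ideal.absNorm_apply _).symm

/-- A chosen generator of `𝔫⁻¹` modulo `𝓞 K`. -/
noncomputable def gen (n : IntIdeal K) : K := (exists_generator n).choose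

theorem isIntegral_mul_gen_iff (n : IntIdeal K) (w : 𝓞 K) :
    IsIntegral ℤ ((w : K) * gen n) ↔ w ∈ (n : Ideal (𝓞 K)) :=
  (exists_generator n).choose_spec.1 w

theorem exists_sub_mul_gen (n : IntIdeal K) {x : K}
    (hx : ∀ a ∈ (n : Ideal (𝓞 K)), IsIntegral ℤ ((a : K) * x)) :
    ∃ v : 𝓞 K, IsIntegral ℤ (x - v * gen n) :=
  (exists_generator n).choose_spec.2 x hx

/-- A representative in `K` of the class `w · gen 𝔫` of `𝔫⁻¹ / 𝓞 K`. -/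
noncomputable def frac (n : IntIdeal K) (w : 𝓞 K ⧸ (n : Ideal (𝓞 K))) : K :=
  (Quotient.out w : 𝓞 K) * gen n

theorem isIntegral_frac_mk_sub (n : IntIdeal K) (v : 𝓞 K) :
    IsIntegral ℤ (frac n (Ideal.Quotient.mk _ v) - v * gen n) := by
  have h : (Ideal.Quotient.mk (n : Ideal (𝓞 K)) (Quotient.out (Ideal.Quotient.mk _ v)) : _) =
      Ideal.Quotient.mk _ v := Ideal.Quotient.mk_out _
  rw [Ideal.Quotient.eq, ← isIntegral_mul_gen_iff] at h
  simpa [frac, sub_mul] using h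

theorem isIntegral_frac_sub_iff (n : IntIdeal K) (w w' : 𝓞 K ⧸ (n : Ideal (𝓞 K))) :
    IsIntegral ℤ (frac n w - frac n w') ↔ w = w' := by
  have : frac n w - frac n w' = ((Quotient.out w - Quotient.out w' : 𝓞 K) : K) * gen n := by
    simp [frac, sub_mul]
  rw [this, isIntegral_mul_gen_iff, ← Ideal.Quotient.eq, Ideal.Quotient.mk_out,
    Ideal.Quotient.mk_out]

theorem exists_isIntegral_sub_frac (n : IntIdeal K) {x : K}
    (hx : ∀ a ∈ (n : Ideal (𝓞 K)), IsIntegral ℤ ((a : K) * x)) :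
    ∃ w, IsIntegral ℤ (x - frac n w) := by
  obtain ⟨v, hv⟩ := exists_sub_mul_gen n hx
  refine ⟨Ideal.Quotient.mk _ v, ?_⟩
  have := hv.sub (isIntegral_frac_mk_sub n v)
  simpa using this

theorem isIntegral_coe_mul_frac (n : IntIdeal K) (w : 𝓞 K ⧸ (n : Ideal (𝓞 K))) {a : 𝓞 K}
    (ha : a ∈ (n : Ideal (𝓞 K))) : IsIntegral ℤ ((a : K) * frac n w) := by
  have : (a : K) * frac n w = ((a * Quotient.out w : 𝓞 K) : K) * gen n := by
    simp [frac, mul_assoc]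
  rw [this, isIntegral_mul_gen_iff]
  exact Ideal.mul_mem_right _ _ ha

theorem den_eq_iff {x : K} {n : IntIdeal K} :
    den x = n ↔ ∀ a : 𝓞 K, a ∈ (n : Ideal (𝓞 K)) ↔ IsIntegral ℤ ((a : K) * x) := by
  constructor
  · rintro rfl a
    exact mem_den_iff x a
  · intro h
    ext a
    rw [mem_den_iff, h]

theorem den_eq_den_of_isIntegral_sub {x y : K} (h : IsIntegral ℤ (x - y)) : den x = den y := by
  rw [den_eq_iff]
  intro a
  rw [mem_den_iff]
  have h1 : IsIntegral ℤ ((a : K) * (x - y)) := (isIntegral_coe a).mul h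
  constructor
  · intro h2
    have := h1.add h2
    rwa [mul_sub, sub_add_cancel] at this
  · intro h2
    have := h2.sub h1
    rwa [mul_sub, sub_sub_cancel] at this

/-- The class `w · gen 𝔫` has exact denominator `𝔫` if and only if `w` is a unit modulo `𝔫`. -/
theorem den_frac_eq_iff (n : IntIdeal K) (w : 𝓞 K ⧸ (n : Ideal (𝓞 K))) :
    den (frac n w) = n ↔ IsUnit w := by
  obtain ⟨v, rfl⟩ := Ideal.Quotient.mk_surjective w
  have hden : den (frac n (Ideal.Quotient.mk _ v)) = den ((v : K) * gen n) :=
    den_eq_den_of_isIntegral_sub (isIntegral_frac_mk_sub n v)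
  rw [hden, den_eq_iff]
  have h : ∀ a : 𝓞 K, IsIntegral ℤ ((a : K) * (v * gen n)) ↔ a * v ∈ (n : Ideal (𝓞 K)) := by
    intro a
    rw [← isIntegral_mul_gen_iff, coe_int_mul, mul_assoc]
  simp only [h]
  constructor
  · intro h
    rw [isUnit_iff_mem_nonZeroDivisors_of_finite, mem_nonZeroDivisors_iff_right]
    intro z hz
    obtain ⟨a, rfl⟩ := Ideal.Quotient.mk_surjective z
    rw [← map_mul, Ideal.Quotient.eq_zero_iff_mem, ← h] at hz
    rwa [Ideal.Quotient.eq_zero_iff_mem]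
  · intro hu a
    rw [← Ideal.Quotient.eq_zero_iff_mem, ← Ideal.Quotient.eq_zero_iff_mem, map_mul,
      hu.mul_left_eq_zero]

theorem den_frac_unit (n : IntIdeal K) (u : (𝓞 K ⧸ (n : Ideal (𝓞 K)))ˣ) : den (frac n u) = n :=
  (den_frac_eq_iff n _).2 u.isUnit

/-- The elements of `K` with denominator `𝔫` are the translates by `𝓞 K` of the representatives of
the units modulo `𝔫`. -/
noncomputable def denEquiv (n : IntIdeal K) :
    (𝓞 K ⧸ (n : Ideal (𝓞 K)))ˣ × 𝓞 K ≃ {γ : K // den γ = n} := by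
  refine Equiv.ofBijective (fun p => ⟨frac n p.1 - p.2, ?_⟩) ⟨?_, ?_⟩
  · exact (den_eq_den_of_isIntegral_sub (by simpa using (isIntegral_coe p.2).neg)).trans
      (den_frac_unit n p.1)
  · rintro ⟨u, o⟩ ⟨u', o'⟩ h
    have h1 : frac n u - o = frac n u' - o' := congrArg Subtype.val h
    have h2 : frac n u - frac n u' = ((o - o' : 𝓞 K) : K) := by
      rw [coe_int_sub]; linear_combination h1
    have h3 : u = u' := Units.ext <| (isIntegral_frac_sub_iff n _ _).1 (h2 ▸ isIntegral_coe _)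
    subst h3
    have h4 : o = o' := RingOfIntegers.coe_injective (by linear_combination -h1)
    rw [h4]
  · rintro ⟨x, rfl⟩
    obtain ⟨w, hw⟩ := exists_isIntegral_sub_frac (den x) (fun a => (mem_den_iff x a).1)
    have hu : IsUnit w :=
      (den_frac_eq_iff (den x) w).1 (den_eq_den_of_isIntegral_sub (by simpa using hw.neg))
    obtain ⟨o, ho⟩ := exists_coe_eq hw
    refine ⟨⟨hu.unit, -o⟩, Subtype.ext ?_⟩
    change frac (den x) w - ((-o : 𝓞 K) : K) = x
    rw [coe_int_neg, ho]
    ring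

/-! ### Boxes and the number of lattice points in a box -/

open mixedEmbedding MeasureTheory

omit [NumberField K] in
theorem mem_convexBodyLT_iff {T : InfinitePlace K → ℝ≥0} {x : mixedSpace K} :
    x ∈ convexBodyLT K T ↔ (∀ w : {w : InfinitePlace K // IsReal w}, ‖x.1 w‖ < T w) ∧
      ∀ w : {w : InfinitePlace K // IsComplex w}, ‖x.2 w‖ < T w := by
  simp only [convexBodyLT, Set.mem_prod, Set.mem_univ_pi, mem_ball_zero_iff]

omit [NumberField K] in
theorem add_mem_convexBodyLT {S T : InfinitePlace K → ℝ≥0} {x y : mixedSpace K}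
    (hx : x ∈ convexBodyLT K S) (hy : y ∈ convexBodyLT K T) :
    x + y ∈ convexBodyLT K (S + T) := by
  rw [mem_convexBodyLT_iff] at *
  exact ⟨fun w => (norm_add_le _ _).trans_lt (add_lt_add (hx.1 w) (hy.1 w)),
    fun w => (norm_add_le _ _).trans_lt (add_lt_add (hx.2 w) (hy.2 w))⟩

omit [NumberField K] in
theorem sub_mem_convexBodyLT {S T : InfinitePlace K → ℝ≥0} {x y : mixedSpace K}
    (hx : x ∈ convexBodyLT K S) (hy : y ∈ convexBodyLT K T) :
    x - y ∈ convexBodyLT K (S + T) := by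
  rw [sub_eq_add_neg]
  exact add_mem_convexBodyLT hx (convexBodyLT_neg_mem K T y hy)

omit [NumberField K] in
theorem convexBodyLT_mono {S T : InfinitePlace K → ℝ≥0} (h : S ≤ T) :
    convexBodyLT K S ⊆ convexBodyLT K T := by
  intro x hx
  rw [mem_convexBodyLT_iff] at *
  exact ⟨fun w => (hx.1 w).trans_le (h w), fun w => (hx.2 w).trans_le (h w)⟩

theorem measurableSet_convexBodyLT (T : InfinitePlace K → ℝ≥0) :
    MeasurableSet (convexBodyLT K T) :=
  (MeasurableSet.univ_pi fun _ => measurableSet_ball).prod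
    (MeasurableSet.univ_pi fun _ => measurableSet_ball)

open scoped Classical in
theorem bigPsi_eq_prod (ψ : InfinitePlace K → IntIdeal K → ℝ≥0) (n : IntIdeal K) :
    bigPsi ψ n = ∏ w, ψ w n ^ mult w := by
  rw [prod_eq_prod_mul_prod]
  simp only [bigPsi]
  congr 1
  · exact Finset.prod_congr rfl fun w _ => by simp [mult, w.2]
  · exact Finset.prod_congr rfl fun w _ => by simp [mult, not_isReal_iff_isComplex.2 w.2]

/-- A nonzero element of `𝔩⁻¹` has norm at least `1 / N(𝔩)`. -/
theorem one_le_norm_mul_absNorm {l : Ideal (𝓞 K)} (hl : l ≠ ⊥) {x : K} (hx : x ≠ 0)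
    (h : ∀ a ∈ l, IsIntegral ℤ ((a : K) * x)) :
    (1 : ℝ) ≤ (∏ w : InfinitePlace K, w x ^ mult w) * Ideal.absNorm l := by
  obtain ⟨b, -, hb⟩ := den_spec x
  have hle : l ≤ den x := fun a ha => (mem_den_iff x a).2 (h a ha)
  have hdvd := Nat.le_of_dvd (Nat.pos_of_ne_zero (Ideal.absNorm_eq_zero_iff.not.2 hl))
    (Ideal.absNorm_dvd_absNorm_of_le hle)
  have hden : Ideal.absNorm (den x : Ideal (𝓞 K)) ≠ 0 := idealNorm_ne_zero (den x)
  have hb0 : b ≠ ⊥ := by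
    rintro rfl
    simp only [FractionalIdeal.coeIdeal_bot, zero_div] at hb
    exact hx (FractionalIdeal.spanSingleton_eq_zero_iff.1 hb)
  have hb1 : 1 ≤ Ideal.absNorm b := Nat.pos_of_ne_zero (Ideal.absNorm_eq_zero_iff.not.2 hb0)
  have e := congrArg FractionalIdeal.absNorm hb
  rw [map_div₀, FractionalIdeal.absNorm_span_singleton, FractionalIdeal.coeIdeal_absNorm,
    FractionalIdeal.coeIdeal_absNorm, eq_div_iff (by exact_mod_cast hden)] at e
  rw [prod_eq_abs_norm]
  have : (1 : ℚ) ≤ |Algebra.norm ℚ x| * Ideal.absNorm l := calc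
    (1 : ℚ) ≤ Ideal.absNorm b := by exact_mod_cast hb1
    _ = |Algebra.norm ℚ x| * Ideal.absNorm (den x : Ideal (𝓞 K)) := e.symm
    _ ≤ _ := by gcongr
  exact_mod_cast this

/-- The nonzero elements of `𝔩⁻¹` in the open box with half-sides `T`. -/
def inverseInBox (l : Ideal (𝓞 K)) (T : InfinitePlace K → ℝ≥0) : Set K :=
  {x | x ≠ 0 ∧ (∀ a ∈ l, IsIntegral ℤ ((a : K) * x)) ∧ mixedEmbedding K x ∈ convexBodyLT K T}

theorem one_lt_prod_mul_absNorm {l : Ideal (𝓞 K)} (hl : l ≠ ⊥) {T : InfinitePlace K → ℝ≥0}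
    (h : (inverseInBox l T).Nonempty) : 1 < (∏ w, T w ^ mult w) * Ideal.absNorm l := by
  obtain ⟨x, hx0, hx, hxT⟩ := h
  rw [convexBodyLT_mem] at hxT
  have hN : 0 < Ideal.absNorm l := Nat.pos_of_ne_zero (Ideal.absNorm_eq_zero_iff.not.2 hl)
  have h1 : (∏ w : InfinitePlace K, w x ^ mult w) < ∏ w, (T w : ℝ) ^ mult w :=
    Finset.prod_lt_prod_of_nonempty (fun w _ => pow_pos (w.pos_iff.2 hx0) _)
      (fun w _ => pow_lt_pow_left₀ (hxT w) (w.pos_iff.2 hx0).le mult_ne_zero)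
      Finset.univ_nonempty
  have h2 : (1 : ℝ) < (∏ w, (T w : ℝ) ^ mult w) * Ideal.absNorm l :=
    (one_le_norm_mul_absNorm hl hx0 hx).trans_lt
      (mul_lt_mul_of_pos_right h1 (by exact_mod_cast hN))
  exact_mod_cast h2

theorem prod_smul_pow_mult (c : ℝ≥0) (T : InfinitePlace K → ℝ≥0) :
    ∏ w, (c • T) w ^ mult w = c ^ Module.finrank ℚ K * ∏ w, T w ^ mult w := by
  simp only [Pi.smul_apply, smul_eq_mul, mul_pow, Finset.prod_mul_distrib,
    Finset.prod_pow_eq_pow_sum, sum_mult_eq]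

open scoped Classical in
/-- A box contains at most a constant multiple of `vol(box) / covol(𝔩⁻¹)` nonzero elements of
`𝔩⁻¹`, with no lower-order term and whatever the shape of the box: the homothetic boxes of norm
`1 / N(𝔩)` centred at these elements are disjoint, because nonzero elements of `𝔩⁻¹` have norm
at least `1 / N(𝔩)`. -/
theorem tsum_inverseInBox_le {l : Ideal (𝓞 K)} (hl : l ≠ ⊥) (T : InfinitePlace K → ℝ≥0) :
    ∑' _ : inverseInBox l T, (1 : ℝ≥0∞) ≤
      ((4 ^ Module.finrank ℚ K * (∏ w, T w ^ mult w) * Ideal.absNorm l : ℝ≥0) : ℝ≥0∞) := by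
  rcases (inverseInBox l T).eq_empty_or_nonempty with h | h
  · simp [h]
  have hPN := one_lt_prod_mul_absNorm hl h
  set d := Module.finrank ℚ K with hd
  have hd0 : d ≠ 0 := Module.finrank_pos.ne'
  set P : ℝ≥0 := ∏ w, T w ^ mult w with hP
  set N : ℝ≥0 := (Ideal.absNorm l : ℝ≥0) with hN
  have hP0 : P ≠ 0 := left_ne_zero_of_mul (zero_lt_one.trans hPN).ne'
  -- the dilation factor for which the small box has norm exactly `1 / N(𝔩)`
  obtain ⟨lam, hlam⟩ : ∃ lam : ℝ≥0, lam ^ d * P * N = 1 := by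
    refine ⟨((P * N)⁻¹) ^ ((d : ℝ)⁻¹), ?_⟩
    rw [NNReal.rpow_inv_natCast_pow _ hd0, mul_assoc,
      inv_mul_cancel₀ (zero_lt_one.trans hPN).ne']
  have hlam0 : lam ≠ 0 := by
    rintro rfl
    simp [hd0] at hlam
  have hlam1 : lam ≤ 1 := by
    by_contra! hc
    have : 1 < lam ^ d * (P * N) := one_lt_mul'' (one_lt_pow₀ hc hd0) hPN
    rw [← mul_assoc, hlam] at this
    exact lt_irrefl _ this
  have := countable_numberField K
  let A : inverseInBox l T → Set (mixedSpace K) := fun θ =>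
    (fun x => x - mixedEmbedding K θ) ⁻¹' convexBodyLT K ((lam / 2) • T)
  have hAm : ∀ θ, MeasurableSet (A θ) := fun θ =>
    (measurable_id.sub_const _) (measurableSet_convexBodyLT _)
  have hAv : ∀ θ, volume (A θ) = volume (convexBodyLT K ((lam / 2) • T)) := fun θ =>
    (measurePreserving_sub_right volume _).measure_preimage
      (measurableSet_convexBodyLT _).nullMeasurableSet
  have hAd : Pairwise (Function.onFun Disjoint A) := by
    intro θ θ' hne
    rw [Function.onFun, Set.disjoint_left]
    intro x hx hx'
    have h1 : mixedEmbedding K (θ' - θ : K) ∈ convexBodyLT K (lam • T) := by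
      have h2 := sub_mem_convexBodyLT hx hx'
      rw [← add_smul, add_halves] at h2
      simpa using h2
    have h3 : (inverseInBox l (lam • T)).Nonempty := by
      refine ⟨θ' - θ, sub_ne_zero.2 fun h => hne (Subtype.ext h.symm), fun a ha => ?_, h1⟩
      rw [mul_sub]
      exact (θ'.2.2.1 a ha).sub (θ.2.2.1 a ha)
    have h4 := one_lt_prod_mul_absNorm hl h3
    rw [prod_smul_pow_mult, hlam] at h4
    exact lt_irrefl _ h4
  have hAs : (⋃ θ, A θ) ⊆ convexBodyLT K ((2 : ℝ≥0) • T) := by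
    refine Set.iUnion_subset fun θ x hx => ?_
    have h1 := add_mem_convexBodyLT hx θ.2.2.2
    rw [sub_add_cancel] at h1
    refine convexBodyLT_mono (fun w => ?_) h1
    have h2 : lam / 2 ≤ 1 := (half_le_self zero_le).trans hlam1
    calc lam / 2 * T w + T w ≤ 1 * T w + T w := by gcongr
      _ = 2 * T w := by ring
  have hsum := (measure_iUnion (μ := volume) hAd hAm).symm.le.trans
    (measure_mono hAs)
  simp only [hAv] at hsum
  rw [← mul_one (volume (convexBodyLT K ((lam / 2) • T))), ENNReal.tsum_mul_left,
    convexBodyLT_volume, convexBodyLT_volume, prod_smul_pow_mult, prod_smul_pow_mult, mul_comm,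
    ← ENNReal.coe_mul, ← ENNReal.coe_mul] at hsum
  set c := convexBodyLTFactor K
  have hc : c ≠ 0 := convexBodyLTFactor_ne_zero K
  have e : c * (2 ^ d * P) = (4 ^ d * P * N) * (c * ((lam / 2) ^ d * P)) := by
    calc c * (2 ^ d * P) = c * (2 ^ d * P) * (lam ^ d * P * N) := by rw [hlam, mul_one]
      _ = ((2 * 2) ^ d * P * N) * (c * ((lam / 2) ^ d * P)) := by
        rw [div_pow, mul_pow]
        field_simp
      _ = _ := by norm_num
  rw [e, ENNReal.coe_mul (4 ^ d * P * N)] at hsum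
  refine (ENNReal.mul_le_mul_iff_left ?_ ENNReal.coe_ne_top).1 hsum
  rw [ENNReal.coe_ne_zero]
  positivity

/-! ### Ramanujan sums -/

/-- The sum of an additive character over the units of a finite commutative ring: since the sum
does not change when the character is shifted by a unit, the second moment of its values at all
shifts bounds it. -/
theorem norm_sum_units_sq_le {R : Type*} [CommRing R] [Fintype R] [Fintype Rˣ]
    (ψ : AddChar R ℂ) :
    ‖∑ u : Rˣ, ψ u‖ ^ 2 ≤ Fintype.card R * Nat.card {w : R | ∀ a, ψ (a * w) = 1} := by
  classical
  set F : R → ℂ := fun a => ∑ u : Rˣ, ψ (a * u) with hF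
  set S : Set R := {w : R | ∀ a, ψ (a * w) = 1} with hS
  have hunit : ∀ v : Rˣ, F v = ∑ u : Rˣ, ψ u := fun v => by
    rw [hF, ← Equiv.sum_comp (Equiv.mulLeft v) (fun u : Rˣ => ψ u)]
    simp
  have horth : ∀ w : R, ∑ a, ψ (a * w) = if w ∈ S then (Fintype.card R : ℂ) else 0 := by
    intro w
    have h := AddChar.sum_eq_ite (ψ.mulShift w)
    simp only [AddChar.mulShift_apply, mul_comm w] at h
    rw [h]
    congr 1
    rw [hS, Set.mem_ofPred_eq, eq_iff_iff, DFunLike.ext_iff]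
    simp [AddChar.mulShift_apply, mul_comm w]
  have hsq : ((∑ a, ‖F a‖ ^ 2 : ℝ) : ℂ) =
      ∑ u : Rˣ, ∑ v : Rˣ, if (u - v : R) ∈ S then (Fintype.card R : ℂ) else 0 := by
    have h1 : ∀ a, ((‖F a‖ ^ 2 : ℝ) : ℂ) = ∑ u : Rˣ, ∑ v : Rˣ, ψ (a * (u - v)) := by
      intro a
      rw [Complex.ofReal_pow, ← Complex.mul_conj', hF, map_sum, Finset.sum_mul_sum]
      refine Finset.sum_congr rfl fun u _ => Finset.sum_congr rfl fun v _ => ?_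
      rw [← AddChar.map_neg_eq_conj, ← AddChar.map_add_eq_mul]
      ring_nf
    rw [Complex.ofReal_sum, Finset.sum_congr rfl fun a _ => h1 a, Finset.sum_comm]
    refine Finset.sum_congr rfl fun u _ => ?_
    rw [Finset.sum_comm]
    exact Finset.sum_congr rfl fun v _ => horth _
  have hcount : ∀ v : Rˣ, (Finset.univ.filter fun u : Rˣ => (u - v : R) ∈ S).card ≤ Nat.card S := by
    intro v
    rw [Nat.card_eq_fintype_card, ← Set.toFinset_card]
    refine Finset.card_le_card_of_injOn (fun u => (u - v : R)) (fun u hu => by simpa using hu) ?_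
    exact fun u _ u' _ h => Units.ext (sub_left_injective h)
  have hle : ∑ a, ‖F a‖ ^ 2 ≤ Fintype.card Rˣ * (Fintype.card R * Nat.card S) := by
    have h2 : ∑ a, ‖F a‖ ^ 2 =
        ∑ v : Rˣ, ∑ u : Rˣ, if (u - v : R) ∈ S then (Fintype.card R : ℝ) else 0 := by
      rw [Finset.sum_comm]
      apply Complex.ofReal_injective
      rw [hsq]
      simp only [Complex.ofReal_sum, apply_ite Complex.ofReal, Complex.ofReal_natCast,
        Complex.ofReal_zero]
    rw [h2, ← nsmul_eq_mul, ← Finset.card_univ]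
    refine Finset.sum_le_card_nsmul _ _ _ fun v _ => ?_
    rw [← Finset.sum_filter, Finset.sum_const, nsmul_eq_mul, mul_comm]
    gcongr
    exact hcount v
  have hge : Fintype.card Rˣ * ‖∑ u : Rˣ, ψ u‖ ^ 2 ≤ ∑ a, ‖F a‖ ^ 2 := by
    calc (Fintype.card Rˣ : ℝ) * ‖∑ u : Rˣ, ψ u‖ ^ 2 = ∑ v : Rˣ, ‖F v‖ ^ 2 := by
          simp [hunit]
      _ = ∑ a ∈ Finset.univ.map ⟨((↑) : Rˣ → R), Units.val_injective⟩, ‖F a‖ ^ 2 := by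
          rw [Finset.sum_map]
          rfl
      _ ≤ _ := Finset.sum_le_univ_sum_of_nonneg fun a => by positivity
  exact le_of_mul_le_mul_left (hge.trans hle) (by exact_mod_cast Fintype.card_pos)

/-- The character of `𝓞 K / 𝔫` obtained from a character of `K / 𝓞 K` by means of the generator of
`𝔫⁻¹` modulo `𝓞 K`. -/
noncomputable def quotientChar (χ : AddChar K ℂ) (hχ : ∀ x, IsIntegral ℤ x → χ x = 1)
    (n : IntIdeal K) : AddChar (𝓞 K ⧸ (n : Ideal (𝓞 K))) ℂ where
  toFun w := χ (frac n w)
  map_zero_eq_one' := hχ _ (by simpa using isIntegral_frac_mk_sub n 0)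
  map_add_eq_mul' w w' := by
    obtain ⟨v, rfl⟩ := Ideal.Quotient.mk_surjective w
    obtain ⟨v', rfl⟩ := Ideal.Quotient.mk_surjective w'
    have h : ∀ v : 𝓞 K, χ (frac n (Ideal.Quotient.mk _ v)) = χ (v * gen n) := fun v => by
      have h1 := hχ _ (isIntegral_frac_mk_sub n v)
      rw [← sub_add_cancel (frac n (Ideal.Quotient.mk _ v)) (v * gen n), AddChar.map_add_eq_mul,
        h1, one_mul]
    rw [← map_add, h, h, h, ← AddChar.map_add_eq_mul, ← add_mul]
    rfl

theorem quotientChar_mk (χ : AddChar K ℂ) (hχ : ∀ x, IsIntegral ℤ x → χ x = 1)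
    (n : IntIdeal K) (v : 𝓞 K) :
    quotientChar χ hχ n (Ideal.Quotient.mk _ v) = χ (v * gen n) := by
  change χ (frac n (Ideal.Quotient.mk _ v)) = _
  rw [← sub_add_cancel (frac n (Ideal.Quotient.mk _ v)) (v * gen n), AddChar.map_add_eq_mul,
    hχ _ (isIntegral_frac_mk_sub n v), one_mul]

/-- For a character `χ` of `K / 𝓞 K` such that the largest `𝓞 K`-module on which it is trivial is
contained in `Q⁻¹ 𝓞 K`, the Ramanujan sum `∑ χ(γ)` over the classes `γ` of denominator `𝔫` is
`O(N(𝔫)^{1/2})`. -/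
theorem norm_ramanujan_sq_le (χ : AddChar K ℂ) (hχ : ∀ x, IsIntegral ℤ x → χ x = 1)
    {Q : 𝓞 K} (hQ : Q ≠ 0)
    (hQχ : ∀ x : K, (∀ a : 𝓞 K, χ (a * x) = 1) → IsIntegral ℤ ((Q : K) * x)) (n : IntIdeal K)
    [Fintype (𝓞 K ⧸ (n : Ideal (𝓞 K)))ˣ] :
    ‖∑ u : (𝓞 K ⧸ (n : Ideal (𝓞 K)))ˣ, χ (frac n u)‖ ^ 2 ≤
      idealNorm n * Ideal.absNorm (Ideal.span {Q}) := by
  have := Fintype.ofFinite (𝓞 K ⧸ (n : Ideal (𝓞 K)))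
  refine (norm_sum_units_sq_le (quotientChar χ hχ n)).trans ?_
  rw [← Nat.card_eq_fintype_card, card_quotient]
  gcongr
  set S := {w | ∀ a, quotientChar χ hχ n (a * w) = 1} with hS
  have hint : ∀ w ∈ S, ∃ o : 𝓞 K, (o : K) = Q * frac n w := by
    intro w hw
    refine exists_coe_eq (hQχ _ fun a => ?_)
    have h := hw (Ideal.Quotient.mk _ a)
    rw [← Ideal.Quotient.mk_out w, ← map_mul, quotientChar_mk] at h
    rw [← h, coe_int_mul, frac, mul_assoc]
  choose! f hf using hint
  have hspan : Ideal.span {Q} ≠ 0 := by simpa [Ideal.zero_eq_bot] using hQ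
  have : Finite (𝓞 K ⧸ Ideal.span {Q}) := Ideal.finiteQuotientOfFreeOfNeBot _ hspan
  rw [Ideal.absNorm_apply, Submodule.cardQuot_apply]
  refine Nat.card_le_card_of_injective
    (fun w : S => (Ideal.Quotient.mk (Ideal.span {Q}) (f w) : 𝓞 K ⧸ Ideal.span {Q})) ?_
  intro w w' h
  rw [Ideal.Quotient.eq, Ideal.mem_span_singleton'] at h
  obtain ⟨o, ho⟩ := h
  have hQK : (Q : K) ≠ 0 := by simpa using hQ
  have h1 : (o : K) * Q = Q * frac n w - Q * frac n w' := by
    rw [← hf w w.2, ← hf w' w'.2]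
    exact congrArg (algebraMap (𝓞 K) K) ho
  have h2 : frac n w - frac n w' = o := by
    apply mul_left_cancel₀ hQK
    linear_combination -h1
  exact Subtype.ext ((isIntegral_frac_sub_iff n _ _).1 (h2 ▸ isIntegral_coe o))

/-- The elements `x` with `ℓ(x 𝓞 K) ⊆ ℤ`, for a nonzero linear form `ℓ`, have a common
denominator: they form the dual lattice of `𝓞 K` for the nondegenerate form `ℓ(xy)`. -/
theorem exists_common_denominator {f : K →ₗ[ℚ] ℚ} (hf : f ≠ 0) :
    ∃ Q : 𝓞 K, Q ≠ 0 ∧ ∀ x : K, (∀ a : 𝓞 K, ∃ m : ℤ, f (a * x) = m) →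
      IsIntegral ℤ ((Q : K) * x) := by
  classical
  let B : LinearMap.BilinForm ℚ K := (LinearMap.mul ℚ K).compr₂ f
  have hBapp : ∀ x y, B x y = f (x * y) := fun x y => rfl
  obtain ⟨z, hz⟩ : ∃ z, f z ≠ 0 := by
    by_contra! h
    exact hf (LinearMap.ext h)
  have hB : B.Nondegenerate := by
    refine ⟨fun x hx => ?_, fun x hx => ?_⟩ <;> by_contra h0
    · exact hz (by simpa [hBapp, mul_div_cancel₀ _ h0] using hx (z / x))
    · exact hz (by simpa [hBapp, div_mul_cancel₀ _ h0] using hx (z / x))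
  let b := integralBasis K
  obtain ⟨Q, hQ⟩ := IsLocalization.exist_integer_multiples (𝓞 K)⁰ Finset.univ (B.dualBasis hB b)
  refine ⟨Q, nonZeroDivisors.coe_ne_zero Q, fun x hx => ?_⟩
  have hmem : x ∈ B.dualSubmodule (Submodule.span ℤ (Set.range b)) := by
    rw [LinearMap.BilinForm.mem_dualSubmodule]
    intro y hy
    rw [mem_span_integralBasis] at hy
    obtain ⟨a, rfl⟩ := hy
    obtain ⟨m, hm⟩ := hx a
    rw [hBapp, mul_comm, Submodule.mem_one]
    exact ⟨m, by rw [show f (algebraMap (𝓞 K) K a * x) = m from hm]; simp⟩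
  rw [LinearMap.BilinForm.dualSubmodule_span_of_basis B hB b] at hmem
  clear hx
  induction hmem using Submodule.span_induction with
  | mem x h =>
    obtain ⟨i, rfl⟩ := h
    obtain ⟨o, ho⟩ := hQ i (Finset.mem_univ i)
    have : ((Q : 𝓞 K) : K) * B.dualBasis hB b i = o := by
      rw [show ((o : K)) = algebraMap (𝓞 K) K o from rfl, ho, Algebra.smul_def]
    rw [this]
    exact isIntegral_coe o
  | zero => simpa using isIntegral_zero
  | add x y _ _ hx hy => rw [mul_add]; exact hx.add hy
  | smul m x _ hx => rw [mul_smul_comm]; exact hx.smul m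

/-! ### Equidistribution with a density in `L²` -/

open MeasureTheory Filter Topology

variable {ι : Type*} [Fintype ι]

theorem integrable_continuousMap {X : Type*} [TopologicalSpace X] [CompactSpace X]
    [MeasurableSpace X] [BorelSpace X] (μ : Measure X) [IsFiniteMeasure μ] (g : C(X, ℂ)) :
    Integrable g μ :=
  Integrable.of_bound (g.continuous.measurable.aestronglyMeasurable) ‖g‖
    (ae_of_all _ fun x => g.norm_coe_le_norm x)

theorem norm_integral_sub_le {X : Type*} [TopologicalSpace X] [CompactSpace X]
    [MeasurableSpace X] [BorelSpace X] (μ : Measure X) [IsProbabilityMeasure μ] (f g : C(X, ℂ)) :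
    ‖∫ x, f x ∂μ - ∫ x, g x ∂μ‖ ≤ ‖f - g‖ := by
  rw [← integral_sub (integrable_continuousMap μ f) (integrable_continuousMap μ g)]
  simpa using norm_integral_le_of_norm_le_const (μ := μ) (C := ‖f - g‖)
    (ae_of_all μ fun x => (f - g).norm_coe_le_norm x)

/-- Weyl's criterion on the torus, for a limit measure with vanishing Fourier coefficients. -/
theorem tendsto_integral_of_mFourier (lam : Measure (UnitAddTorus ι)) [IsProbabilityMeasure lam]
    (hlam : ∀ k : ι → ℤ, k ≠ 0 → ∫ x, UnitAddTorus.mFourier k x ∂lam = 0)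
    (ν : ℕ → Measure (UnitAddTorus ι)) [∀ j, IsProbabilityMeasure (ν j)]
    (hF : ∀ k : ι → ℤ, k ≠ 0 →
      Tendsto (fun j => ∫ x, UnitAddTorus.mFourier k x ∂ν j) atTop (𝓝 0))
    (g : C(UnitAddTorus ι, ℂ)) :
    Tendsto (fun j => ∫ x, g x ∂ν j) atTop (𝓝 (∫ x, g x ∂lam)) := by
  have hspan : ∀ P ∈ Submodule.span ℂ (Set.range (UnitAddTorus.mFourier (d := ι))),
      Tendsto (fun j => ∫ x, P x ∂ν j) atTop (𝓝 (∫ x, P x ∂lam)) := by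
    intro P hP
    induction hP using Submodule.span_induction with
    | mem P h =>
      obtain ⟨k, rfl⟩ := h
      by_cases hk : k = 0
      · subst hk
        simp [UnitAddTorus.mFourier_zero]
      · rw [hlam k hk]
        exact hF k hk
    | zero => simp
    | add P P' _ _ h h' =>
      have e : ∀ μ : Measure (UnitAddTorus ι), IsProbabilityMeasure μ →
          ∫ x, (P + P') x ∂μ = ∫ x, P x ∂μ + ∫ x, P' x ∂μ := fun μ _ =>
        integral_add (integrable_continuousMap μ P) (integrable_continuousMap μ P')
      simp only [e _ inferInstance]
      exact h.add h'
    | smul c P _ h =>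
      simp only [ContinuousMap.smul_apply, integral_smul]
      exact h.const_smul c
  have hg : g ∈
      (Submodule.span ℂ (Set.range (UnitAddTorus.mFourier (d := ι)))).topologicalClosure :=
    (UnitAddTorus.span_mFourier_closure_eq_top (d := ι)).symm ▸ Submodule.mem_top
  rw [Metric.tendsto_atTop]
  intro ε hε
  obtain ⟨P, hP, hgP⟩ := Metric.mem_closure_iff.1 hg (ε / 3) (by positivity)
  obtain ⟨N, hN⟩ := Metric.tendsto_atTop.1 (hspan P hP) (ε / 3) (by positivity)
  refine ⟨N, fun j hj => ?_⟩
  rw [dist_eq_norm] at hgP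
  calc dist (∫ x, g x ∂ν j) (∫ x, g x ∂lam)
      ≤ dist (∫ x, g x ∂ν j) (∫ x, P x ∂ν j) + dist (∫ x, P x ∂ν j) (∫ x, P x ∂lam) +
        dist (∫ x, P x ∂lam) (∫ x, g x ∂lam) := dist_triangle4 _ _ _ _
    _ < ε / 3 + ε / 3 + ε / 3 := by
        refine add_lt_add (add_lt_add ?_ (hN j hj)) ?_
        · rw [dist_eq_norm]
          exact (norm_integral_sub_le (ν j) g P).trans_lt hgP
        · rw [dist_comm, dist_eq_norm]
          exact (norm_integral_sub_le lam g P).trans_lt hgP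
    _ = ε := by ring

/-- Probability measures on the torus which are uniformly bounded as functionals on `L²(lam)` and
converge to `lam` in the sense of Weyl's criterion cannot asymptotically avoid a set of positive
measure. -/
theorem measure_eq_zero_of_tendsto (lam : Measure (UnitAddTorus ι)) [IsProbabilityMeasure lam]
    (hlam : ∀ k : ι → ℤ, k ≠ 0 → ∫ x, UnitAddTorus.mFourier k x ∂lam = 0)
    (ν : ℕ → Measure (UnitAddTorus ι)) [∀ j, IsProbabilityMeasure (ν j)]
    (hF : ∀ k : ι → ℤ, k ≠ 0 →
      Tendsto (fun j => ∫ x, UnitAddTorus.mFourier k x ∂ν j) atTop (𝓝 0))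
    (C : ℝ≥0) (hL2 : ∀ j, ∀ h : UnitAddTorus ι → ℝ≥0∞, Measurable h →
      ∫⁻ x, h x ∂ν j ≤ C * (∫⁻ x, h x ^ (2 : ℝ) ∂lam) ^ (1 / 2 : ℝ))
    {B : Set (UnitAddTorus ι)} (hB : MeasurableSet B)
    (hBν : Tendsto (fun j => ν j B) atTop (𝓝 0)) : lam B = 0 := by
  set f : UnitAddTorus ι → ℂ := B.indicator fun _ => 1 with hf
  have hfm : Measurable f := measurable_const.indicator hB
  have hfb : ∀ x, ‖f x‖ ≤ 1 := fun x => by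
    by_cases hx : x ∈ B <;> simp [hf, hx]
  have hfint : ∀ μ : Measure (UnitAddTorus ι), IsProbabilityMeasure μ → Integrable f μ := fun μ _ =>
    Integrable.of_bound hfm.aestronglyMeasurable 1 (ae_of_all _ hfb)
  have hfi : ∀ μ : Measure (UnitAddTorus ι), ∫ x, f x ∂μ = (μ.real B : ℂ) := fun μ => by
    rw [hf, integral_indicator hB]
    simp
  -- it suffices to bound `lam B` by every positive multiple of `C + 1`
  suffices h : ∀ ε : ℝ≥0, 0 < ε → lam.real B ≤ (C + 1) * ε by
    have h0 : lam.real B ≤ 0 := by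
      refine le_of_forall_pos_le_add fun δ hδ => ?_
      lift δ to ℝ≥0 using hδ.le
      have h1 := h (δ / (C + 1)) (div_pos (by exact_mod_cast hδ) (by positivity))
      have h2 : ((C : ℝ) + 1) * ((δ / (C + 1) : ℝ≥0) : ℝ) = δ := by
        push_cast
        field_simp
      linarith
    have := le_antisymm h0 measureReal_nonneg
    rwa [measureReal_eq_zero_iff] at this
  intro ε hε
  -- a continuous function close to the indicator function of `B` in `L²(lam)`
  obtain ⟨g', hg', -⟩ := (MemLp.of_bound (p := 2) (μ := lam) hfm.aestronglyMeasurable 1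
    (ae_of_all _ hfb)).exists_boundedContinuous_eLpNorm_sub_le (by simp)
    (ε := ε) (by exact_mod_cast hε.ne')
  set g : C(UnitAddTorus ι, ℂ) := g'.toContinuousMap with hg
  have hgm : Measurable fun x => ‖g x - f x‖ₑ := (g.continuous.measurable.sub hfm).enorm
  have hgε : (∫⁻ x, ‖g x - f x‖ₑ ^ (2 : ℝ) ∂lam) ^ (1 / 2 : ℝ) ≤ ε := by
    rw [eLpNorm_eq_lintegral_rpow_enorm_toReal (by simp) (by simp)] at hg'
    refine le_trans (le_of_eq ?_) hg'
    simp only [ENNReal.toReal_ofNat, Pi.sub_apply]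
    congr 1
    exact lintegral_congr fun x => by rw [enorm_sub_rev]; rfl
  have hdiff : ∀ (μ : Measure (UnitAddTorus ι)) (D : ℝ≥0), IsProbabilityMeasure μ →
      (∫⁻ x, ‖g x - f x‖ₑ ∂μ ≤ D * (∫⁻ x, ‖g x - f x‖ₑ ^ (2 : ℝ) ∂lam) ^ (1 / 2 : ℝ)) →
      ‖∫ x, g x ∂μ - (μ.real B : ℂ)‖ ≤ D * ε := by
    intro μ D _ hD
    rw [← hfi, ← integral_sub (integrable_continuousMap μ g) (hfint μ inferInstance)]
    have h1 : ‖∫ x, (g x - f x) ∂μ‖ₑ ≤ ((D * ε : ℝ≥0) : ℝ≥0∞) :=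
      (enorm_integral_le_lintegral_enorm _).trans <| hD.trans <| by
        rw [ENNReal.coe_mul]; gcongr
    rw [enorm_eq_nnnorm, ENNReal.coe_le_coe] at h1
    exact_mod_cast h1
  have hlim : ‖∫ x, g x ∂lam‖ ≤ C * ε := by
    have h1 : Tendsto (fun j => ((ν j).real B : ℂ)) atTop (𝓝 ((0 : ℝ) : ℂ)) :=
      (Complex.continuous_ofReal.tendsto 0).comp
        ((ENNReal.tendsto_toReal ENNReal.zero_ne_top).comp hBν)
    have h2 := ((tendsto_integral_of_mFourier lam hlam ν hF g).sub h1).norm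
    simp only [Complex.ofReal_zero, sub_zero] at h2
    exact le_of_tendsto h2 (Eventually.of_forall fun j =>
      hdiff (ν j) C inferInstance (hL2 j _ hgm))
  have hlam2 : ‖∫ x, g x ∂lam - (lam.real B : ℂ)‖ ≤ (1 : ℝ≥0) * ε := by
    refine hdiff lam 1 inferInstance ?_
    have h := ENNReal.lintegral_mul_le_Lp_mul_Lq lam Real.HolderConjugate.two_two
      (f := fun x => ‖g x - f x‖ₑ) (g := fun _ => 1) hgm.aemeasurable aemeasurable_const
    simp only [Pi.mul_apply, mul_one, ENNReal.one_rpow, lintegral_const, measure_univ] at h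
    simpa using h
  have h3 : ‖(lam.real B : ℂ)‖ ≤ C * ε + (1 : ℝ≥0) * ε := by
    calc ‖(lam.real B : ℂ)‖
        = ‖∫ x, g x ∂lam - (∫ x, g x ∂lam - (lam.real B : ℂ))‖ := by rw [sub_sub_cancel]
      _ ≤ _ := (norm_sub_le _ _).trans (add_le_add hlim hlam2)
  rw [Complex.norm_real, Real.norm_of_nonneg measureReal_nonneg] at h3
  simpa [add_mul] using h3

/-! ### First and second moments of the number of approximations -/

section Moments

open scoped Classical
open mixedEmbedding MeasureTheory

noncomputable instance fintypeUnits (n : IntIdeal K) : Fintype (𝓞 K ⧸ (n : Ideal (𝓞 K)))ˣ :=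
  Fintype.ofFinite _

theorem card_units (n : IntIdeal K) :
    Fintype.card (𝓞 K ⧸ (n : Ideal (𝓞 K)))ˣ = eulerPhi n :=
  Nat.card_eq_fintype_card.symm

/-- The open box with half-sides `T` centred at the image of `γ`. -/
def boxAt (T : InfinitePlace K → ℝ≥0) (γ : K) : Set (mixedSpace K) :=
  (fun x => x - mixedEmbedding K γ) ⁻¹' convexBodyLT K T

theorem measurableSet_boxAt (T : InfinitePlace K → ℝ≥0) (γ : K) : MeasurableSet (boxAt T γ) :=
  (measurable_id.sub_const _) (measurableSet_convexBodyLT T)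

theorem volume_boxAt (T : InfinitePlace K → ℝ≥0) (γ : K) :
    volume (boxAt T γ) = volume (convexBodyLT K T) :=
  (measurePreserving_sub_right volume _).measure_preimage
    (measurableSet_convexBodyLT _).nullMeasurableSet

omit [NumberField K] in
theorem add_mem_boxAt_iff {T : InfinitePlace K → ℝ≥0} {γ : K} {x : mixedSpace K} (o : K) :
    x + mixedEmbedding K o ∈ boxAt T γ ↔ x ∈ boxAt T (γ - o) := by
  have : x + mixedEmbedding K o - mixedEmbedding K γ = x - mixedEmbedding K (γ - o) := by
    rw [map_sub]; abel
  simp only [boxAt, Set.mem_preimage, this]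

/-- The number of elements `γ` of denominator `𝔫` such that `x` lies in the box of half-sides
`ψ(𝔫)` centred at `γ`. -/
noncomputable def hits (ψ : InfinitePlace K → IntIdeal K → ℝ≥0) (n : IntIdeal K)
    (x : mixedSpace K) : ℝ≥0∞ :=
  ∑' γ : {γ : K // den γ = n}, (boxAt (fun w => ψ w n) γ).indicator 1 x

/-- The sum of the Lebesgue measures on the boxes of half-sides `ψ(𝔫)` centred at representatives
modulo `𝓞 K` of the elements of denominator `𝔫`. -/
noncomputable def fracMeasure (ψ : InfinitePlace K → IntIdeal K → ℝ≥0) (n : IntIdeal K) :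
    Measure (mixedSpace K) :=
  ∑ u : (𝓞 K ⧸ (n : Ideal (𝓞 K)))ˣ, volume.restrict (boxAt (fun w => ψ w n) (frac n u))

variable (ψ : InfinitePlace K → IntIdeal K → ℝ≥0)

theorem measurable_hits (n : IntIdeal K) : Measurable (hits ψ n) := by
  have := countable_numberField K
  exact Measurable.tsum fun γ => measurable_one.indicator (measurableSet_boxAt _ _)

theorem hits_add (n : IntIdeal K) (x : mixedSpace K) (o : 𝓞 K) :
    hits ψ n (x + mixedEmbedding K o) = hits ψ n x := by
  have hden : ∀ γ : K, den γ = n ↔ den (γ - o) = n := fun γ => by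
    rw [den_eq_den_of_isIntegral_sub (x := γ - o) (y := γ)]
    simpa using (isIntegral_coe o).neg
  let e : {γ : K // den γ = n} ≃ {γ : K // den γ = n} := (Equiv.subRight (o : K)).subtypeEquiv hden
  refine (tsum_congr fun γ => ?_).trans
    (e.tsum_eq fun γ : {γ : K // den γ = n} => (boxAt (fun w => ψ w n) γ).indicator 1 x)
  simp only [Set.indicator_apply, add_mem_boxAt_iff]
  rfl

/-- The ring of integers, viewed as the integer lattice of the mixed space. -/
noncomputable def integerEquiv : 𝓞 K ≃ mixedEmbedding.integerLattice K :=
  Equiv.ofBijective (fun o => ⟨mixedEmbedding K o, o, rfl⟩)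
    ⟨fun _ _ h => RingOfIntegers.coe_injective
      (mixedEmbedding_injective K (congrArg Subtype.val h : _)),
      fun ⟨_, o, ho⟩ => ⟨o, Subtype.ext ho⟩⟩

variable (K) in
/-- The fundamental parallelepiped of the integer lattice spanned by an integral basis. -/
def fundDomain : Set (mixedSpace K) := ZSpan.fundamentalDomain (latticeBasis K)

variable (K) in
theorem isAddFundamentalDomain_fundDomain :
    IsAddFundamentalDomain (mixedEmbedding.integerLattice K) (fundDomain K) volume :=
  fundamentalDomain_integerLattice K

/-- Instance search does not see the integer lattice, a `ℤ`-submodule, as an additive subgroup. -/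
instance vaddInvariantMeasure_integerLattice :
    VAddInvariantMeasure (mixedEmbedding.integerLattice K) (mixedSpace K) volume :=
  inferInstanceAs (VAddInvariantMeasure (mixedEmbedding.integerLattice K).toAddSubgroup
    (mixedSpace K) volume)

/-- Unfolding: integrating a function periodic modulo `𝓞 K` against `fracMeasure` amounts to
integrating it over a fundamental domain with the weight `hits`. -/
theorem lintegral_fracMeasure {h : mixedSpace K → ℝ≥0∞} (hm : Measurable h)
    (hper : ∀ (o : 𝓞 K) x, h (x + mixedEmbedding K o) = h x) (n : IntIdeal K) :
    ∫⁻ x, h x ∂fracMeasure ψ n = ∫⁻ x in fundDomain K, hits ψ n x * h x := by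
  have := countable_numberField K
  have hu : ∀ u : (𝓞 K ⧸ (n : Ideal (𝓞 K)))ˣ,
      ∫⁻ x in boxAt (fun w => ψ w n) (frac n u), h x =
        ∑' o : 𝓞 K, ∫⁻ x in fundDomain K,
          (boxAt (fun w => ψ w n) (frac n u - o)).indicator 1 x * h x := by
    intro u
    rw [← lintegral_indicator (measurableSet_boxAt _ _),
      (isAddFundamentalDomain_fundDomain K).lintegral_eq_tsum'', ← integerEquiv.tsum_eq]
    refine tsum_congr fun o => lintegral_congr fun x => ?_
    have e : integerEquiv o +ᵥ x = x + mixedEmbedding K o := add_comm _ _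
    rw [e, Set.indicator_apply, Set.indicator_apply, add_mem_boxAt_iff, hper]
    split_ifs <;> simp
  rw [fracMeasure, lintegral_finsetSum_measure, Finset.sum_congr rfl fun u _ => hu u,
    ← tsum_fintype (L := .unconditional _), ← ENNReal.tsum_prod]
  simp only [hits, ← ENNReal.tsum_mul_right]
  have hmeas : ∀ γ : {γ : K // den γ = n}, AEMeasurable (fun x =>
      (boxAt (fun w => ψ w n) (γ : K)).indicator 1 x * h x) (volume.restrict (fundDomain K)) :=
    fun γ => ((measurable_one.indicator (measurableSet_boxAt _ _)).mul hm).aemeasurable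
  rw [lintegral_tsum hmeas, ← (denEquiv n).tsum_eq]
  rfl

theorem fracMeasure_univ (n : IntIdeal K) :
    fracMeasure ψ n Set.univ = convexBodyLTFactor K * (eulerPhi n * bigPsi ψ n) := by
  simp only [fracMeasure, Measure.coe_finsetSum, Finset.sum_apply, Measure.restrict_apply_univ,
    volume_boxAt, convexBodyLT_volume, bigPsi_eq_prod, Finset.sum_const, Finset.card_univ,
    card_units, nsmul_eq_mul]
  ring

/-- The intersection of two boxes is contained in a box whose half-sides are the smaller ones. -/
theorem volume_boxAt_inter_le (S T : InfinitePlace K → ℝ≥0) (γ δ : K) :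
    volume (boxAt S γ ∩ boxAt T δ) ≤ volume (convexBodyLT K (S ⊓ T)) := by
  let y : mixedSpace K :=
    (fun w => if S w ≤ T w then (mixedEmbedding K γ).1 w else (mixedEmbedding K δ).1 w,
      fun w => if S w ≤ T w then (mixedEmbedding K γ).2 w else (mixedEmbedding K δ).2 w)
  have hsub : boxAt S γ ∩ boxAt T δ ⊆ (fun x => x - y) ⁻¹' convexBodyLT K (S ⊓ T) := by
    rintro x ⟨hx, hx'⟩
    simp only [boxAt, Set.mem_preimage, mem_convexBodyLT_iff] at hx hx' ⊢
    constructor <;> intro w <;> by_cases h : S w ≤ T w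
    · simpa [y, h] using hx.1 w
    · simpa [y, h, (not_le.1 h).le] using hx'.1 w
    · simpa [y, h] using hx.2 w
    · simpa [y, h, (not_le.1 h).le] using hx'.2 w
  refine (measure_mono hsub).trans (le_of_eq ?_)
  exact (measurePreserving_sub_right volume _).measure_preimage
    (measurableSet_convexBodyLT _).nullMeasurableSet

/-- A given `θ` has at most `N(𝔫 + 𝔪)` representations as a difference of an element of
denominator `𝔫` (up to `𝓞 K`) and an element of denominator `𝔪`. -/
theorem card_representations_le (n m : IntIdeal K) (θ : K) :
    (Finset.univ.filter fun u : (𝓞 K ⧸ (n : Ideal (𝓞 K)))ˣ => den (frac n u - θ) = m).card ≤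
      Ideal.absNorm ((n : Ideal (𝓞 K)) ⊔ m) := by
  have hg : (n : Ideal (𝓞 K)) ⊔ m ≠ ⊥ := fun h =>
    nonZeroDivisors.coe_ne_zero n (le_bot_iff.1 (le_sup_left.trans h.le))
  let g : IntIdeal K := ⟨(n : Ideal (𝓞 K)) ⊔ m, mem_nonZeroDivisors_of_ne_zero hg⟩
  rcases Finset.eq_empty_or_nonempty (Finset.univ.filter
    fun u : (𝓞 K ⧸ (n : Ideal (𝓞 K)))ˣ => den (frac n u - θ) = m) with h | ⟨u₀, hu₀⟩
  · simp [h]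
  rw [Finset.mem_filter_univ] at hu₀
  have hex : ∀ u : (𝓞 K ⧸ (n : Ideal (𝓞 K)))ˣ, den (frac n u - θ) = m →
      ∃ w, IsIntegral ℤ (frac n u - frac n u₀ - frac g w) := by
    intro u hu
    refine exists_isIntegral_sub_frac g fun a ha => ?_
    obtain ⟨b, hb, c, hc, rfl⟩ := Submodule.mem_sup.1 ha
    have h1 := (isIntegral_coe_mul_frac n u hb).sub (isIntegral_coe_mul_frac n u₀ hb)
    have h2 := (den_eq_iff.1 hu c).1 hc
    have h3 := (den_eq_iff.1 hu₀ c).1 hc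
    have e : (((b + c : 𝓞 K)) : K) * (frac n u - frac n u₀) =
        (b * frac n u - b * frac n u₀) + (c * (frac n u - θ) - c * (frac n u₀ - θ)) := by
      change ((b : K) + c) * _ = _
      ring
    rw [e]
    exact h1.add (h2.sub h3)
  choose! f hf using hex
  have := finite_quotient g
  have := Fintype.ofFinite (𝓞 K ⧸ (g : Ideal (𝓞 K)))
  have hcard : Ideal.absNorm ((n : Ideal (𝓞 K)) ⊔ m) =
      (Finset.univ : Finset (𝓞 K ⧸ (g : Ideal (𝓞 K)))).card := by
    rw [Finset.card_univ, ← Nat.card_eq_fintype_card, card_quotient]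
    rfl
  rw [hcard]
  refine Finset.card_le_card_of_injOn f (fun _ _ => Finset.mem_coe.2 (Finset.mem_univ _)) ?_
  intro u hu u' hu' h
  rw [Finset.mem_coe, Finset.mem_filter_univ] at hu hu'
  have h1 := (hf u hu).sub (hf u' hu')
  rw [h, sub_sub_sub_cancel_right, sub_sub_sub_cancel_right] at h1
  exact Units.ext ((isIntegral_frac_sub_iff n _ _).1 h1)

/-- The number of pairs of elements of denominators `𝔫` (up to `𝓞 K`) and `𝔪` whose difference lies
in `S`. -/
theorem tsum_pairs_le (n m : IntIdeal K) (S : Set K) :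
    ∑ u : (𝓞 K ⧸ (n : Ideal (𝓞 K)))ˣ, ∑' δ : {δ : K // den δ = m},
        S.indicator (1 : K → ℝ≥0∞) (frac n u - δ) ≤
      Ideal.absNorm ((n : Ideal (𝓞 K)) ⊔ m) * ∑' _ : S, (1 : ℝ≥0∞) := by
  have h1 : ∀ u : (𝓞 K ⧸ (n : Ideal (𝓞 K)))ˣ,
      ∑' δ : {δ : K // den δ = m}, S.indicator (1 : K → ℝ≥0∞) (frac n u - δ) =
        ∑' θ : K, if den (frac n u - θ) = m then S.indicator (1 : K → ℝ≥0∞) θ else 0 := by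
    intro u
    rw [← (Equiv.subLeft (frac n u)).tsum_eq]
    simp only [Equiv.subLeft_apply, sub_sub_cancel]
    refine (tsum_subtype {δ : K | den δ = m} fun δ =>
      S.indicator (1 : K → ℝ≥0∞) (frac n u - δ)).trans ?_
    exact tsum_congr fun δ => by simp only [Set.indicator_apply, Set.mem_ofPred_eq]
  rw [Finset.sum_congr rfl fun u _ => h1 u, ← tsum_fintype (L := .unconditional _),
    ENNReal.tsum_comm, tsum_subtype S fun _ => (1 : ℝ≥0∞), ← ENNReal.tsum_mul_left]
  refine ENNReal.tsum_le_tsum fun θ => ?_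
  rw [tsum_fintype, ← Finset.sum_filter, Finset.sum_const, nsmul_eq_mul]
  refine mul_le_mul' ?_ le_rfl
  exact_mod_cast card_representations_le n m θ

/-- The overlap of the boxes attached to two ideals: apart from the diagonal contribution when the
ideals are equal, it is bounded by that of independent sets, with `N` in place of `Φ`. -/
theorem lintegral_hits_fracMeasure_le (n m : IntIdeal K) :
    ∫⁻ x, hits ψ m x ∂fracMeasure ψ n ≤
      (if m = n then convexBodyLTFactor K * (eulerPhi n * bigPsi ψ n : ℝ≥0∞) else 0) +
        convexBodyLTFactor K * 8 ^ Module.finrank ℚ K *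
          ((idealNorm n * bigPsi ψ n) * (idealNorm m * bigPsi ψ m) : ℝ≥0∞) := by
  have := countable_numberField K
  set S : InfinitePlace K → ℝ≥0 := fun w => ψ w n with hS
  set T : InfinitePlace K → ℝ≥0 := fun w => ψ w m with hT
  set l : Ideal (𝓞 K) := (n : Ideal (𝓞 K)) ⊓ m with hl
  have hl0 : l ≠ ⊥ := by
    intro h
    have h1 : (n : Ideal (𝓞 K)) * m ≤ ⊥ := Ideal.mul_le_inf.trans h.le
    exact mul_ne_zero (nonZeroDivisors.coe_ne_zero n) (nonZeroDivisors.coe_ne_zero m)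
      (le_bot_iff.1 h1)
  set A : Set K := inverseInBox l ((2 : ℝ≥0) • (S ⊔ T)) with hA
  set v := volume (convexBodyLT K (S ⊓ T)) with hv
  have hint : ∫⁻ x, hits ψ m x ∂fracMeasure ψ n =
      ∑ u : (𝓞 K ⧸ (n : Ideal (𝓞 K)))ˣ, ∑' δ : {δ : K // den δ = m},
        volume (boxAt S (frac n u) ∩ boxAt T δ) := by
    rw [fracMeasure, lintegral_finsetSum_measure]
    refine Finset.sum_congr rfl fun u _ => ?_
    simp only [hits]
    rw [lintegral_tsum fun γ => (measurable_one.indicator (measurableSet_boxAt _ _)).aemeasurable]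
    refine tsum_congr fun δ => ?_
    rw [lintegral_indicator_one (measurableSet_boxAt _ _),
      Measure.restrict_apply (measurableSet_boxAt _ _), Set.inter_comm]
  have hterm : ∀ (u : (𝓞 K ⧸ (n : Ideal (𝓞 K)))ˣ) (δ : {δ : K // den δ = m}),
      volume (boxAt S (frac n u) ∩ boxAt T δ) ≤
        (if (δ : K) = frac n u then volume (convexBodyLT K S) else 0) +
          v * A.indicator 1 (frac n u - δ) := by
    intro u δ
    by_cases h : (δ : K) = frac n u
    · rw [if_pos h]
      exact (measure_mono Set.inter_subset_left).trans ((volume_boxAt _ _).le.trans le_self_add)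
    rw [if_neg h, zero_add]
    rcases Set.eq_empty_or_nonempty (boxAt S (frac n u) ∩ boxAt T δ) with he | ⟨x, hx, hx'⟩
    · simp [he]
    have hmem : frac n u - δ ∈ A := by
      refine ⟨sub_ne_zero.2 (Ne.symm h), fun a ha => ?_, ?_⟩
      · rw [mul_sub]
        exact (isIntegral_coe_mul_frac n u ha.1).sub ((den_eq_iff.1 δ.2 a).1 ha.2)
      · have h1 := sub_mem_convexBodyLT hx' hx
        rw [sub_sub_sub_cancel_left, ← map_sub] at h1
        refine convexBodyLT_mono (fun w => ?_) h1
        change T w + S w ≤ 2 * max (S w) (T w)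
        rw [two_mul]
        exact add_le_add (le_max_right _ _) (le_max_left _ _)
    rw [Set.indicator_of_mem hmem, Pi.one_apply, mul_one]
    exact volume_boxAt_inter_le _ _ _ _
  have hdiag : ∑ u : (𝓞 K ⧸ (n : Ideal (𝓞 K)))ˣ, ∑' δ : {δ : K // den δ = m},
      (if (δ : K) = frac n u then volume (convexBodyLT K S) else 0) ≤
      if m = n then convexBodyLTFactor K * (eulerPhi n * bigPsi ψ n : ℝ≥0∞) else 0 := by
    split_ifs with hmn
    · rw [bigPsi_eq_prod, mul_left_comm, ← convexBodyLT_volume, ← card_units, ← Finset.card_univ,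
        ← nsmul_eq_mul]
      refine Finset.sum_le_card_nsmul _ _ _ fun u _ => ?_
      rw [tsum_eq_single ⟨frac n u, (den_frac_unit n u).trans hmn.symm⟩]
      · simp [hS]
      · intro δ hδ
        rw [if_neg fun h => hδ (Subtype.ext h)]
    · refine (Finset.sum_eq_zero fun u _ => ENNReal.tsum_eq_zero.2 fun δ => if_neg ?_).le
      intro h
      exact hmn (by rw [← δ.2, h, den_frac_unit])
  have hcount := (tsum_pairs_le n m A).trans (mul_le_mul_right (tsum_inverseInBox_le hl0 _) _)
  have hnorm : Ideal.absNorm ((n : Ideal (𝓞 K)) ⊔ m) * Ideal.absNorm l =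
      idealNorm n * idealNorm m := by
    rw [← map_mul, Ideal.sup_mul_inf, map_mul]
    rfl
  have hprod : (∏ w, (S ⊓ T) w ^ mult w) * ∏ w, (S ⊔ T) w ^ mult w =
      bigPsi ψ n * bigPsi ψ m := by
    rw [bigPsi_eq_prod, bigPsi_eq_prod, ← Finset.prod_mul_distrib, ← Finset.prod_mul_distrib]
    refine Finset.prod_congr rfl fun w _ => ?_
    rw [← mul_pow, ← mul_pow, Pi.inf_apply, Pi.sup_apply, min_mul_max]
  rw [hint]
  calc ∑ u : (𝓞 K ⧸ (n : Ideal (𝓞 K)))ˣ, ∑' δ : {δ : K // den δ = m},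
        volume (boxAt S (frac n u) ∩ boxAt T δ)
      ≤ ∑ u : (𝓞 K ⧸ (n : Ideal (𝓞 K)))ˣ, ∑' δ : {δ : K // den δ = m},
        ((if (δ : K) = frac n u then volume (convexBodyLT K S) else 0) +
          v * A.indicator 1 (frac n u - δ)) :=
        Finset.sum_le_sum fun u _ => ENNReal.tsum_le_tsum fun δ => hterm u δ
    _ = (∑ u : (𝓞 K ⧸ (n : Ideal (𝓞 K)))ˣ, ∑' δ : {δ : K // den δ = m},
          (if (δ : K) = frac n u then volume (convexBodyLT K S) else 0)) +
        v * ∑ u : (𝓞 K ⧸ (n : Ideal (𝓞 K)))ˣ, ∑' δ : {δ : K // den δ = m},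
          A.indicator 1 (frac n u - δ) := by
        simp only [ENNReal.tsum_add, ENNReal.tsum_mul_left, Finset.sum_add_distrib,
          Finset.mul_sum]
    _ ≤ _ := by
        refine add_le_add hdiag ((mul_le_mul_right hcount _).trans (le_of_eq ?_))
        rw [hv, convexBodyLT_volume, prod_smul_pow_mult]
        have e : convexBodyLTFactor K * (∏ w, (S ⊓ T) w ^ mult w) *
            ((Ideal.absNorm ((n : Ideal (𝓞 K)) ⊔ m) : ℝ≥0) *
              (4 ^ Module.finrank ℚ K * (2 ^ Module.finrank ℚ K * ∏ w, (S ⊔ T) w ^ mult w) *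
                Ideal.absNorm l)) =
            convexBodyLTFactor K * 8 ^ Module.finrank ℚ K *
              ((idealNorm n * bigPsi ψ n) * (idealNorm m * bigPsi ψ m)) := by
          have h8 : (8 : ℝ≥0) = 4 * 2 := by norm_num
          have hnorm' : (Ideal.absNorm ((n : Ideal (𝓞 K)) ⊔ m) : ℝ≥0) * Ideal.absNorm l =
            idealNorm n * idealNorm m := by exact_mod_cast hnorm
          rw [h8, mul_pow]
          linear_combination (convexBodyLTFactor K * 4 ^ Module.finrank ℚ K *
            2 ^ Module.finrank ℚ K) * (bigPsi ψ n * bigPsi ψ m * hnorm' +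
            (Ideal.absNorm ((n : Ideal (𝓞 K)) ⊔ m) : ℝ≥0) * Ideal.absNorm l * hprod)
        exact_mod_cast congrArg ((↑) : ℝ≥0 → ℝ≥0∞) e

end Moments

/-! ### Characters of the torus `(ℝ^s × ℂ^t) / 𝓞 K` -/

section Torus

open scoped Classical
open mixedEmbedding MeasureTheory Module.Free Filter Topology

variable (K)

/-- The projection of the mixed space to the torus, in the coordinates of an integral basis. -/
noncomputable def torusMap (x : mixedSpace K) : UnitAddTorus (ChooseBasisIndex ℤ (𝓞 K)) :=
  fun i => ((latticeBasis K).repr x i : UnitAddCircle)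

theorem continuous_repr : Continuous fun x : mixedSpace K => ⇑((latticeBasis K).repr x) :=
  (latticeBasis K).equivFun.toLinearMap.continuous_of_finiteDimensional

theorem continuous_torusMap : Continuous (torusMap K) :=
  continuous_pi fun i => (AddCircle.continuous_mk' 1).comp
    ((continuous_apply i).comp (continuous_repr K))

theorem torusMap_add (x y : mixedSpace K) : torusMap K (x + y) = torusMap K x + torusMap K y := by
  ext i
  simp [torusMap]

theorem torusMap_integer (o : 𝓞 K) : torusMap K (mixedEmbedding K o) = 0 := by
  ext i
  rw [torusMap, latticeBasis_repr_apply, Pi.zero_apply, AddCircle.coe_eq_zero_iff]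
  refine ⟨(RingOfIntegers.basis K).repr o i, ?_⟩
  rw [integralBasis_repr_apply]
  simp

/-- A measurable section of `torusMap`. -/
noncomputable def torusSection (t : UnitAddTorus (ChooseBasisIndex ℤ (𝓞 K))) : mixedSpace K :=
  (latticeBasis K).equivFun.symm (UnitAddTorus.measurableEquivPiIoc 0 t).1

theorem measurable_torusSection : Measurable (torusSection K) :=
  ((latticeBasis K).equivFun.symm.toLinearMap.continuous_of_finiteDimensional).measurable.comp
    (measurable_subtype_coe.comp (UnitAddTorus.measurableEquivPiIoc 0).measurable)

theorem torusMap_torusSection (t : UnitAddTorus (ChooseBasisIndex ℤ (𝓞 K))) :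
    torusMap K (torusSection K t) = t := by
  conv_rhs => rw [← (UnitAddTorus.measurableEquivPiIoc 0).symm_apply_apply t]
  ext i
  rw [UnitAddTorus.coe_symm_measurableEquivPiIoc_apply, torusMap, torusSection,
    ← Module.Basis.equivFun_apply, LinearEquiv.apply_symm_apply]

variable {K} in
theorem exists_eq_add_of_torusMap_eq {x y : mixedSpace K} (h : torusMap K x = torusMap K y) :
    ∃ o : 𝓞 K, x = y + mixedEmbedding K o := by
  have hm : ∀ i, ∃ m : ℤ, (latticeBasis K).repr (x - y) i = m := by
    intro i
    have h1 : (((latticeBasis K).repr (x - y) i : ℝ) : UnitAddCircle) = 0 := by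
      have := congrFun h i
      rw [map_sub, Finsupp.sub_apply, AddCircle.coe_sub, sub_eq_zero]
      exact this
    obtain ⟨m, hm⟩ := (AddCircle.coe_eq_zero_iff 1).1 h1
    exact ⟨m, by simpa using hm.symm⟩
  choose m hm using hm
  have hmem : x - y ∈ Submodule.span ℤ (Set.range (latticeBasis K)) := by
    rw [← (latticeBasis K).sum_repr (x - y)]
    refine Submodule.sum_mem _ fun i _ => ?_
    rw [hm, Int.cast_smul_eq_zsmul]
    exact Submodule.smul_mem _ _ (Submodule.subset_span (Set.mem_range_self i))
  rw [mem_span_latticeBasis] at hmem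
  obtain ⟨o, ho⟩ := hmem
  exact ⟨o, by rw [← sub_eq_iff_eq_add']; exact ho.symm⟩

/-- The character of the mixed space with frequency `k` in the coordinates of an integral basis. -/
noncomputable def latticeChar (k : ChooseBasisIndex ℤ (𝓞 K) → ℤ) : AddChar (mixedSpace K) ℂ where
  toFun x := UnitAddTorus.mFourier k (torusMap K x)
  map_zero_eq_one' := by
    have h : torusMap K 0 = 0 := by simpa using torusMap_integer K 0
    rw [h]
    simp [UnitAddTorus.mFourier]
  map_add_eq_mul' x y := by
    rw [torusMap_add]
    simp only [UnitAddTorus.mFourier, ContinuousMap.coe_mk, Pi.add_apply,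
      ← Finset.prod_mul_distrib]
    refine Finset.prod_congr rfl fun i _ => ?_
    simp [fourier_apply, AddCircle.toCircle_add]

theorem latticeChar_apply (k : ChooseBasisIndex ℤ (𝓞 K) → ℤ) (x : mixedSpace K) :
    latticeChar K k x = UnitAddTorus.mFourier k (torusMap K x) := rfl

theorem latticeChar_eq_exp (k : ChooseBasisIndex ℤ (𝓞 K) → ℤ) (x : mixedSpace K) :
    latticeChar K k x =
      Complex.exp (2 * Real.pi * Complex.I * ((∑ i, k i * (latticeBasis K).repr x i : ℝ) : ℂ)) := by
  rw [latticeChar_apply]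
  simp only [UnitAddTorus.mFourier, ContinuousMap.coe_mk, torusMap, fourier_coe_apply]
  rw [← Complex.exp_sum]
  congr 1
  push_cast
  rw [Finset.mul_sum]
  refine Finset.sum_congr rfl fun i _ => ?_
  simp
  ring

theorem continuous_latticeChar (k : ChooseBasisIndex ℤ (𝓞 K) → ℤ) :
    Continuous (latticeChar K k) :=
  (UnitAddTorus.mFourier k).continuous.comp (continuous_torusMap K)

theorem norm_latticeChar_le (k : ChooseBasisIndex ℤ (𝓞 K) → ℤ) (x : mixedSpace K) :
    ‖latticeChar K k x‖ ≤ 1 :=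
  ((UnitAddTorus.mFourier k).norm_coe_le_norm _).trans UnitAddTorus.mFourier_norm.le

theorem latticeChar_integer (k : ChooseBasisIndex ℤ (𝓞 K) → ℤ) (o : 𝓞 K) :
    latticeChar K k (mixedEmbedding K o) = 1 := by
  rw [latticeChar_apply, torusMap_integer]
  simp [UnitAddTorus.mFourier]

variable {K}

/-- The `𝓞 K`-submodules of `K` on which a nontrivial character of the torus is trivial have a
common denominator. -/
theorem exists_latticeChar_denominator {k : ChooseBasisIndex ℤ (𝓞 K) → ℤ} (hk : k ≠ 0) :
    ∃ Q : 𝓞 K, Q ≠ 0 ∧ ∀ x : K,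
      (∀ a : 𝓞 K, latticeChar K k (mixedEmbedding K (a * x)) = 1) →
        IsIntegral ℤ ((Q : K) * x) := by
  let f : K →ₗ[ℚ] ℚ := ∑ i, (k i : ℚ) • (integralBasis K).coord i
  have hfapp : ∀ x, f x = ∑ i, k i * (integralBasis K).repr x i := fun x => by
    simp [f, LinearMap.sum_apply]
  have hf : f ≠ 0 := by
    intro h
    apply hk
    ext i
    have h1 := hfapp (integralBasis K i)
    rw [h] at h1
    simpa [Finsupp.single_apply] using h1.symm
  obtain ⟨Q, hQ0, hQ⟩ := exists_common_denominator hf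
  refine ⟨Q, hQ0, fun x hx => hQ x fun a => ?_⟩
  have h1 := hx a
  rw [latticeChar_eq_exp, Complex.exp_eq_one_iff] at h1
  obtain ⟨m, hm⟩ := h1
  refine ⟨m, ?_⟩
  have h2 : ((∑ i, k i * (latticeBasis K).repr (mixedEmbedding K (a * x)) i : ℝ) : ℂ) = m := by
    have h3 : (2 * Real.pi * Complex.I : ℂ) ≠ 0 := Complex.two_pi_I_ne_zero
    apply mul_left_cancel₀ h3
    rw [hm]; ring
  have h4 : (∑ i, k i * (latticeBasis K).repr (mixedEmbedding K (a * x)) i : ℝ) = m := by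
    exact_mod_cast h2
  simp only [latticeBasis_repr_apply] at h4
  rw [hfapp]
  exact_mod_cast h4

theorem volume_fundDomain_ne_zero : volume (fundDomain K) ≠ 0 :=
  ZSpan.measure_fundamentalDomain_ne_zero _

theorem volume_fundDomain_ne_top : volume (fundDomain K) ≠ ∞ :=
  (ZSpan.fundamentalDomain_isBounded _).measure_lt_top.ne

open scoped Pointwise in
theorem setIntegral_latticeChar {k : ChooseBasisIndex ℤ (𝓞 K) → ℤ} (hk : k ≠ 0) :
    ∫ x in fundDomain K, latticeChar K k x = 0 := by
  obtain ⟨i, hi⟩ := Function.ne_iff.1 hk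
  rw [Pi.zero_apply] at hi
  have := countable_numberField K
  have : Countable (𝓞 K) := (RingOfIntegers.coe_injective (K := K)).countable
  have : Countable (mixedEmbedding.integerLattice K) := integerEquiv.symm.injective.countable
  -- translation by a vector at which the character takes the value `-1`
  set y : mixedSpace K := (1 / (2 * k i : ℝ)) • latticeBasis K i with hy
  have hy1 : latticeChar K k y = -1 := by
    rw [latticeChar_eq_exp]
    have h : (∑ j, k j * (latticeBasis K).repr y j : ℝ) = 1 / 2 := by
      have hi' : (k i : ℝ) ≠ 0 := by exact_mod_cast hi
      have hrepr : ∀ j, (latticeBasis K).repr y j = if i = j then 1 / (2 * k i : ℝ) else 0 := by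
        intro j
        rw [hy, map_smul, Finsupp.smul_apply, Module.Basis.repr_self, Finsupp.single_apply]
        simp
      simp only [hrepr, mul_ite, mul_zero, Finset.sum_ite_eq, Finset.mem_univ, if_true]
      field_simp
    rw [h, ← Complex.exp_pi_mul_I]
    congr 1
    push_cast
    ring
  have hinv : ∀ (g : mixedEmbedding.integerLattice K) (x : mixedSpace K),
      latticeChar K k (g +ᵥ x) = latticeChar K k x := by
    rintro ⟨_, o, rfl⟩ x
    change latticeChar K k (mixedEmbedding K o + x) = _
    rw [AddChar.map_add_eq_mul, latticeChar_integer, one_mul]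
  have h1 := (isAddFundamentalDomain_fundDomain K).setIntegral_eq
    ((isAddFundamentalDomain_fundDomain K).vadd_of_comm y) hinv
  have h2 : ∫ x in y +ᵥ fundDomain K, latticeChar K k x =
      ∫ x in fundDomain K, latticeChar K k (y + x) := by
    rw [← (measurePreserving_add_left volume y).setIntegral_preimage_emb
      (measurableEmbedding_addLeft y)]
    congr 2
    ext x
    rw [Set.mem_preimage, Set.mem_vadd_set_iff_neg_vadd_mem]
    change -y + (y + x) ∈ _ ↔ _
    rw [neg_add_cancel_left]
  rw [h2] at h1
  simp only [AddChar.map_add_eq_mul, hy1, neg_one_mul, integral_neg] at h1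
  exact self_eq_neg.1 h1

theorem setIntegral_latticeChar_boxAt (T : InfinitePlace K → ℝ≥0) (γ : K)
    (k : ChooseBasisIndex ℤ (𝓞 K) → ℤ) :
    ∫ x in boxAt T γ, latticeChar K k x =
      latticeChar K k (mixedEmbedding K γ) * ∫ x in convexBodyLT K T, latticeChar K k x := by
  rw [← integral_const_mul]
  refine Eq.trans ?_ ((measurePreserving_sub_right volume
    (mixedEmbedding K γ)).setIntegral_preimage_emb (measurableEmbedding_subRight _) _ _)
  simp only [← AddChar.map_add_eq_mul, add_sub_cancel]
  rfl

instance isFiniteMeasure_fracMeasure (ψ : InfinitePlace K → IntIdeal K → ℝ≥0) (n : IntIdeal K) :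
    IsFiniteMeasure (fracMeasure ψ n) := by
  refine ⟨?_⟩
  rw [fracMeasure_univ]
  exact ENNReal.mul_lt_top ENNReal.coe_lt_top
    (ENNReal.mul_lt_top (ENNReal.natCast_lt_top _) ENNReal.coe_lt_top)

/-- A nontrivial Fourier coefficient of `fracMeasure` is a Ramanujan sum times a Fourier
coefficient of the box, and the latter is at most the volume of the box. -/
theorem exists_norm_integral_latticeChar_le {k : ChooseBasisIndex ℤ (𝓞 K) → ℤ} (hk : k ≠ 0) :
    ∃ C : ℝ, 0 ≤ C ∧ ∀ (ψ : InfinitePlace K → IntIdeal K → ℝ≥0) (n : IntIdeal K),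
      ‖∫ x, latticeChar K k x ∂fracMeasure ψ n‖ ≤ C * (bigPsi ψ n * √(idealNorm n)) := by
  obtain ⟨Q, hQ0, hQ⟩ := exists_latticeChar_denominator hk
  refine ⟨convexBodyLTFactor K * √(Ideal.absNorm (Ideal.span {Q})), by positivity,
    fun ψ n => ?_⟩
  let χ : AddChar K ℂ := (latticeChar K k).compAddMonoidHom (mixedEmbedding K : K →+ mixedSpace K)
  have hχ : ∀ x, IsIntegral ℤ x → χ x = 1 := fun x hx => by
    obtain ⟨o, rfl⟩ := exists_coe_eq hx
    exact latticeChar_integer K k o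
  have hfin : volume (convexBodyLT K fun w => ψ w n) < ∞ := by
    rw [convexBodyLT_volume]
    exact ENNReal.mul_lt_top ENNReal.coe_lt_top ENNReal.coe_lt_top
  have hsum : ∫ x, latticeChar K k x ∂fracMeasure ψ n =
      (∑ u : (𝓞 K ⧸ (n : Ideal (𝓞 K)))ˣ, χ (frac n u)) *
        ∫ x in convexBodyLT K (fun w => ψ w n), latticeChar K k x := by
    rw [fracMeasure, integral_finsetSum_measure, Finset.sum_mul]
    · exact Finset.sum_congr rfl fun u _ => setIntegral_latticeChar_boxAt _ _ _
    · intro u _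
      refine IntegrableOn.of_bound ?_ (continuous_latticeChar K k).aestronglyMeasurable 1
        (ae_of_all _ (norm_latticeChar_le K k))
      rwa [volume_boxAt]
  have hbox : ‖∫ x in convexBodyLT K (fun w => ψ w n), latticeChar K k x‖ ≤
      convexBodyLTFactor K * bigPsi ψ n := by
    have h := norm_setIntegral_le_of_norm_le_const hfin (C := 1)
      (fun x _ => norm_latticeChar_le K k x)
    rw [one_mul, measureReal_def, convexBodyLT_volume] at h
    rw [bigPsi_eq_prod]
    simpa using h
  have hram : ‖∑ u : (𝓞 K ⧸ (n : Ideal (𝓞 K)))ˣ, χ (frac n u)‖ ≤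
      √(idealNorm n) * √(Ideal.absNorm (Ideal.span {Q})) := by
    rw [← Real.sqrt_mul (by positivity)]
    exact Real.le_sqrt_of_sq_le (norm_ramanujan_sq_le χ hχ hQ0 hQ n)
  rw [hsum, norm_mul]
  calc _ ≤ (√(idealNorm n) * √(Ideal.absNorm (Ideal.span {Q}))) *
        (convexBodyLTFactor K * bigPsi ψ n) := by gcongr
    _ = _ := by ring

end Torus

/-! ### Partial sums and the full measure of the approximable points -/

section Conclusion

open scoped Classical
open mixedEmbedding MeasureTheory Module.Free Filter Topology

variable (ψ : InfinitePlace K → IntIdeal K → ℝ≥0)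

theorem mem_idealsUpTo {R : ℕ} {n : IntIdeal K} : n ∈ idealsUpTo K R ↔ idealNorm n ≤ R := by
  simp [idealsUpTo]

/-- The partial sums of `Φ Ψ`. -/
noncomputable def phiSum (R : ℕ) : ℝ≥0 := ∑ n ∈ idealsUpTo K R, eulerPhi n * bigPsi ψ n

/-- The partial sums of `N Ψ`. -/
noncomputable def normSum (R : ℕ) : ℝ≥0 := ∑ n ∈ idealsUpTo K R, idealNorm n * bigPsi ψ n

/-- The number of approximations of `x` by elements whose denominator has norm at most `R`. -/
noncomputable def hitsUpTo (R : ℕ) (x : mixedSpace K) : ℝ≥0∞ := ∑ n ∈ idealsUpTo K R, hits ψ n x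

/-- The sum of the measures `fracMeasure` over the ideals of norm at most `R`. -/
noncomputable def fracMeasureUpTo (R : ℕ) : Measure (mixedSpace K) :=
  ∑ n ∈ idealsUpTo K R, fracMeasure ψ n

instance isFiniteMeasure_fracMeasureUpTo (R : ℕ) : IsFiniteMeasure (fracMeasureUpTo ψ R) := by
  rw [fracMeasureUpTo]
  infer_instance

theorem measurable_hitsUpTo (R : ℕ) : Measurable (hitsUpTo ψ R) :=
  Finset.measurable_fun_sum _ fun n _ => measurable_hits ψ n

theorem hitsUpTo_add (R : ℕ) (o : 𝓞 K) (x : mixedSpace K) :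
    hitsUpTo ψ R (x + mixedEmbedding K o) = hitsUpTo ψ R x :=
  Finset.sum_congr rfl fun n _ => hits_add ψ n x o

theorem fracMeasureUpTo_univ (R : ℕ) :
    fracMeasureUpTo ψ R Set.univ = ((convexBodyLTFactor K * phiSum ψ R : ℝ≥0) : ℝ≥0∞) := by
  simp only [fracMeasureUpTo, Measure.coe_finsetSum, Finset.sum_apply, fracMeasure_univ, phiSum]
  push_cast
  rw [Finset.mul_sum]

theorem lintegral_fracMeasureUpTo {h : mixedSpace K → ℝ≥0∞} (hm : Measurable h)
    (hper : ∀ (o : 𝓞 K) x, h (x + mixedEmbedding K o) = h x) (R : ℕ) :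
    ∫⁻ x, h x ∂fracMeasureUpTo ψ R = ∫⁻ x in fundDomain K, hitsUpTo ψ R x * h x := by
  rw [fracMeasureUpTo, lintegral_finsetSum_measure,
    Finset.sum_congr rfl fun n _ => lintegral_fracMeasure ψ hm hper n]
  simp only [hitsUpTo, Finset.sum_mul]
  rw [lintegral_finsetSum]
  exact fun n _ => (measurable_hits ψ n).mul hm

theorem lintegral_hitsUpTo_sq_le (R : ℕ) :
    ∫⁻ x in fundDomain K, hitsUpTo ψ R x ^ (2 : ℝ) ≤
      ((convexBodyLTFactor K * phiSum ψ R +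
        convexBodyLTFactor K * 8 ^ Module.finrank ℚ K * normSum ψ R ^ 2 : ℝ≥0) : ℝ≥0∞) := by
  have h1 : ∫⁻ x in fundDomain K, hitsUpTo ψ R x ^ (2 : ℝ) =
      ∑ n ∈ idealsUpTo K R, ∑ m ∈ idealsUpTo K R, ∫⁻ x, hits ψ m x ∂fracMeasure ψ n := by
    simp only [ENNReal.rpow_two, sq]
    rw [← lintegral_fracMeasureUpTo ψ (measurable_hitsUpTo ψ R) (hitsUpTo_add ψ R) R,
      fracMeasureUpTo, lintegral_finsetSum_measure]
    refine Finset.sum_congr rfl fun n _ => ?_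
    simp only [hitsUpTo]
    rw [lintegral_finsetSum]
    exact fun m _ => measurable_hits ψ m
  rw [h1]
  refine (Finset.sum_le_sum fun n _ => Finset.sum_le_sum fun m _ =>
    lintegral_hits_fracMeasure_le ψ n m).trans (le_of_eq ?_)
  simp only [Finset.sum_add_distrib, ← Finset.mul_sum, ← Finset.sum_mul]
  rw [phiSum, normSum]
  push_cast
  congr 1
  · rw [Finset.mul_sum]
    refine Finset.sum_congr rfl fun n hn => ?_
    simp [Finset.sum_ite_eq', hn]
  · rw [sq]

theorem tendsto_phiSum (hdiv : ∑' n : IntIdeal K, (eulerPhi n : ℝ≥0∞) * (bigPsi ψ n : ℝ≥0∞) = ∞) :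
    Tendsto (phiSum ψ) atTop atTop := by
  refine tendsto_atTop.2 fun M => ?_
  have h1 : (M : ℝ≥0∞) < ∑' n : IntIdeal K, (eulerPhi n : ℝ≥0∞) * (bigPsi ψ n : ℝ≥0∞) := by
    rw [hdiv]; exact ENNReal.coe_lt_top
  rw [ENNReal.tsum_eq_iSup_sum, lt_iSup_iff] at h1
  obtain ⟨s, hs⟩ := h1
  filter_upwards [eventually_ge_atTop (s.sup idealNorm)] with R hR
  have h2 : (M : ℝ≥0∞) ≤ phiSum ψ R := by
    refine hs.le.trans ?_
    rw [phiSum]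
    push_cast
    exact Finset.sum_le_sum_of_subset fun n hn =>
      mem_idealsUpTo.2 ((Finset.le_sup (f := idealNorm) hn).trans hR)
  exact_mod_cast h2

/-- The contribution of the Ramanujan sums is negligible with respect to `∑ N Ψ`. -/
theorem exists_sum_sqrt_le {ε : ℝ} (hε : 0 < ε) :
    ∃ M : ℝ, ∀ R, ∑ n ∈ idealsUpTo K R, (bigPsi ψ n * √(idealNorm n) : ℝ) ≤
      M + ε * normSum ψ R := by
  obtain ⟨L, hL⟩ := exists_nat_ge ((ε ^ 2)⁻¹)
  refine ⟨∑ n ∈ idealsUpTo K L, (bigPsi ψ n * √(idealNorm n) : ℝ), fun R => ?_⟩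
  rw [← Finset.sum_filter_add_sum_filter_not (idealsUpTo K R) (· ∈ idealsUpTo K L)]
  refine add_le_add ?_ ?_
  · refine Finset.sum_le_sum_of_subset_of_nonneg (fun n hn => (Finset.mem_filter.1 hn).2) ?_
    intros; positivity
  · rw [normSum]
    push_cast
    rw [Finset.mul_sum]
    refine (Finset.sum_le_sum (g := fun n => ε * (idealNorm n * bigPsi ψ n : ℝ))
      fun n hn => ?_).trans
      (Finset.sum_le_sum_of_subset_of_nonneg (Finset.filter_subset _ _) (by intros; positivity))
    have hn' := (Finset.mem_filter.1 hn).2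
    rw [mem_idealsUpTo, not_le] at hn'
    have h1 : (ε ^ 2)⁻¹ ≤ idealNorm n := hL.trans (by exact_mod_cast hn'.le)
    have h2 : √(idealNorm n : ℝ) ≤ ε * idealNorm n := by
      rw [Real.sqrt_le_left (by positivity), mul_pow]
      rw [inv_le_iff_one_le_mul₀ (by positivity)] at h1
      nlinarith [(Nat.cast_nonneg (idealNorm n) : (0 : ℝ) ≤ idealNorm n)]
    calc (bigPsi ψ n * √(idealNorm n) : ℝ) ≤ bigPsi ψ n * (ε * idealNorm n) := by gcongr
      _ = _ := by ring

variable (K) in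
/-- The normalized Lebesgue measure of the mixed space modulo `𝓞 K`, viewed on the torus. -/
noncomputable def torusMeasure : Measure (UnitAddTorus (ChooseBasisIndex ℤ (𝓞 K))) :=
  (volume (fundDomain K))⁻¹ • (volume.restrict (fundDomain K)).map (torusMap K)

instance isProbabilityMeasure_torusMeasure : IsProbabilityMeasure (torusMeasure K) := ⟨by
  rw [torusMeasure, Measure.smul_apply, Measure.map_apply (continuous_torusMap K).measurable
    MeasurableSet.univ, Set.preimage_univ, Measure.restrict_apply_univ, smul_eq_mul,
    ENNReal.inv_mul_cancel volume_fundDomain_ne_zero volume_fundDomain_ne_top]⟩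

theorem integral_mFourier_torusMeasure {k : ChooseBasisIndex ℤ (𝓞 K) → ℤ} (hk : k ≠ 0) :
    ∫ x, UnitAddTorus.mFourier k x ∂torusMeasure K = 0 := by
  rw [torusMeasure, integral_smul_measure, integral_map (continuous_torusMap K).aemeasurable
    (UnitAddTorus.mFourier k).continuous.aestronglyMeasurable]
  have h := setIntegral_latticeChar hk
  simp only [latticeChar_apply] at h
  rw [h, smul_zero]

theorem setLIntegral_comp_torusMap {h : UnitAddTorus (ChooseBasisIndex ℤ (𝓞 K)) → ℝ≥0∞}
    (hm : Measurable h) :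
    ∫⁻ x in fundDomain K, h (torusMap K x) =
      volume (fundDomain K) * ∫⁻ x, h x ∂torusMeasure K := by
  rw [torusMeasure, lintegral_smul_measure, lintegral_map hm (continuous_torusMap K).measurable,
    smul_eq_mul, ← mul_assoc,
    ENNReal.mul_inv_cancel volume_fundDomain_ne_zero volume_fundDomain_ne_top, one_mul]

/-- The probability measure on the torus whose density is proportional to the number of
approximations by elements whose denominator has norm at most `R`. -/
noncomputable def approxMeasure (R : ℕ) : Measure (UnitAddTorus (ChooseBasisIndex ℤ (𝓞 K))) :=
  ((convexBodyLTFactor K * phiSum ψ R : ℝ≥0) : ℝ≥0∞)⁻¹ • (fracMeasureUpTo ψ R).map (torusMap K)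

theorem convexBodyLTFactor_mul_phiSum_pos {R : ℕ} (hR : 1 ≤ phiSum ψ R) :
    0 < convexBodyLTFactor K * phiSum ψ R :=
  mul_pos (pos_iff_ne_zero.2 (convexBodyLTFactor_ne_zero K)) (zero_lt_one.trans_le hR)

theorem isProbabilityMeasure_approxMeasure {R : ℕ} (hR : 1 ≤ phiSum ψ R) :
    IsProbabilityMeasure (approxMeasure ψ R) := ⟨by
  rw [approxMeasure, Measure.smul_apply, Measure.map_apply (continuous_torusMap K).measurable
    MeasurableSet.univ, Set.preimage_univ, fracMeasureUpTo_univ, smul_eq_mul,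
    ENNReal.inv_mul_cancel
      (by exact_mod_cast (convexBodyLTFactor_mul_phiSum_pos ψ hR).ne') ENNReal.coe_ne_top]⟩

theorem lintegral_approxMeasure {h : UnitAddTorus (ChooseBasisIndex ℤ (𝓞 K)) → ℝ≥0∞}
    (hm : Measurable h) (R : ℕ) :
    ∫⁻ x, h x ∂approxMeasure ψ R = ((convexBodyLTFactor K * phiSum ψ R : ℝ≥0) : ℝ≥0∞)⁻¹ *
      ∫⁻ x in fundDomain K, hitsUpTo ψ R x * h (torusMap K x) := by
  have hcont := continuous_torusMap K
  rw [approxMeasure, lintegral_smul_measure, lintegral_map hm hcont.measurable,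
    lintegral_fracMeasureUpTo ψ (h := fun x => h (torusMap K x)) (hm.comp hcont.measurable)
      (fun o x => by rw [torusMap_add, torusMap_integer, add_zero]), smul_eq_mul]

theorem norm_integral_mFourier_approxMeasure_le {k : ChooseBasisIndex ℤ (𝓞 K) → ℤ} (hk : k ≠ 0) :
    ∃ C : ℝ, 0 ≤ C ∧ ∀ R, ‖∫ x, UnitAddTorus.mFourier k x ∂approxMeasure ψ R‖ ≤
      (convexBodyLTFactor K * phiSum ψ R : ℝ)⁻¹ *
        (C * ∑ n ∈ idealsUpTo K R, (bigPsi ψ n * √(idealNorm n) : ℝ)) := by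
  obtain ⟨C, hC0, hC⟩ := exists_norm_integral_latticeChar_le hk
  refine ⟨C, hC0, fun R => ?_⟩
  rw [approxMeasure, integral_smul_measure, integral_map (continuous_torusMap K).aemeasurable
    (UnitAddTorus.mFourier k).continuous.aestronglyMeasurable, _root_.norm_smul]
  have e : ‖(((convexBodyLTFactor K * phiSum ψ R : ℝ≥0) : ℝ≥0∞)⁻¹).toReal‖ =
      (convexBodyLTFactor K * phiSum ψ R : ℝ)⁻¹ := by
    rw [ENNReal.toReal_inv, ENNReal.coe_toReal, Real.norm_of_nonneg (by positivity),
      NNReal.coe_mul]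
  rw [e]
  refine mul_le_mul_of_nonneg_left ?_ (by positivity)
  simp only [← latticeChar_apply]
  rw [fracMeasureUpTo, integral_finsetSum_measure, Finset.mul_sum]
  · exact norm_sum_le_of_le _ fun n _ => hC ψ n
  · exact fun n _ => Integrable.of_bound (continuous_latticeChar K k).aestronglyMeasurable 1
      (ae_of_all _ (norm_latticeChar_le K k))

theorem tendsto_integral_mFourier_approxMeasure {η : ℝ≥0} (hη : 0 < η) {φ : ℕ → ℕ}
    (hφ : ∀ j, η * normSum ψ (φ j) ≤ phiSum ψ (φ j) ∧ 1 ≤ phiSum ψ (φ j))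
    (hlim : Tendsto (fun j => phiSum ψ (φ j)) atTop atTop)
    {k : ChooseBasisIndex ℤ (𝓞 K) → ℤ} (hk : k ≠ 0) :
    Tendsto (fun j => ∫ x, UnitAddTorus.mFourier k x ∂approxMeasure ψ (φ j)) atTop (𝓝 0) := by
  obtain ⟨C, hC0, hC⟩ := norm_integral_mFourier_approxMeasure_le ψ hk
  have hc : (0 : ℝ) < convexBodyLTFactor K :=
    NNReal.coe_pos.2 (pos_iff_ne_zero.2 (convexBodyLTFactor_ne_zero K))
  set c : ℝ := (convexBodyLTFactor K : ℝ)
  have hη' : (0 : ℝ) < η := NNReal.coe_pos.2 hη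
  rw [Metric.tendsto_atTop]
  intro ε hε
  obtain ⟨M, hM⟩ := exists_sum_sqrt_le ψ (ε := ε * c * η / (2 * (C + 1))) (by positivity)
  have hlim' : Tendsto (fun j => (phiSum ψ (φ j) : ℝ)) atTop atTop :=
    NNReal.tendsto_coe_atTop.2 hlim
  obtain ⟨J, hJ⟩ := eventually_atTop.1 (hlim'.eventually_gt_atTop (2 * (C * |M|) / (c * ε)))
  refine ⟨J, fun j hj => ?_⟩
  rw [dist_zero_right]
  refine (hC (φ j)).trans_lt ?_
  have h1 : (η : ℝ) * normSum ψ (φ j) ≤ phiSum ψ (φ j) := by exact_mod_cast (hφ j).1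
  have hp0 : (1 : ℝ) ≤ phiSum ψ (φ j) := by exact_mod_cast (hφ j).2
  have h2 := hJ j hj
  have h3 := hM (φ j)
  generalize (∑ n ∈ idealsUpTo K (φ j), (bigPsi ψ n * √(idealNorm n) : ℝ)) = s at h3 ⊢
  generalize (normSum ψ (φ j) : ℝ) = b at h1 h3
  generalize (phiSum ψ (φ j) : ℝ) = a at h1 h2 hp0 ⊢
  rw [div_lt_iff₀ (by positivity)] at h2
  rw [inv_mul_lt_iff₀ (by positivity)]
  calc C * s ≤ C * (|M| + ε * c * η / (2 * (C + 1)) * b) :=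
        mul_le_mul_of_nonneg_left (h3.trans (by gcongr; exact le_abs_self M)) hC0
    _ = C * |M| + C / (C + 1) * (ε * c / 2 * (η * b)) := by field_simp
    _ ≤ C * |M| + C / (C + 1) * (ε * c / 2 * a) := by gcongr
    _ ≤ C * |M| + 1 * (ε * c / 2 * a) := by
        gcongr
        rw [div_le_one (by positivity)]
        linarith
    _ < c * a * ε := by linarith

/-- The second moment bounds the measures `approxMeasure` as functionals on `L²`, uniformly in
those `R` for which `∑ Φ Ψ` is at least a fixed proportion of `∑ N Ψ`. -/
theorem exists_lintegral_approxMeasure_le {η : ℝ≥0} (hη : 0 < η) :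
    ∃ C : ℝ≥0, ∀ R, η * normSum ψ R ≤ phiSum ψ R → 1 ≤ phiSum ψ R →
      ∀ h : UnitAddTorus (ChooseBasisIndex ℤ (𝓞 K)) → ℝ≥0∞, Measurable h →
        ∫⁻ x, h x ∂approxMeasure ψ R ≤
          C * (∫⁻ x, h x ^ (2 : ℝ) ∂torusMeasure K) ^ (1 / 2 : ℝ) := by
  set c := convexBodyLTFactor K with hc
  set V : ℝ≥0 := (volume (fundDomain K)).toNNReal with hV
  have hVn : volume (fundDomain K) = (V : ℝ≥0∞) :=
    (ENNReal.coe_toNNReal volume_fundDomain_ne_top).symm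
  set D : ℝ≥0 := c + c * 8 ^ Module.finrank ℚ K * (η⁻¹) ^ 2 with hD
  refine ⟨c⁻¹ * (D * V) ^ (1 / 2 : ℝ), fun R hR1 hR2 h hm => ?_⟩
  have hpos := convexBodyLTFactor_mul_phiSum_pos ψ hR2
  rw [← hc] at hpos
  have hsq : ∫⁻ x in fundDomain K, hitsUpTo ψ R x ^ (2 : ℝ) ≤
      ((D * phiSum ψ R ^ 2 : ℝ≥0) : ℝ≥0∞) := by
    refine (lintegral_hitsUpTo_sq_le ψ R).trans ?_
    rw [ENNReal.coe_le_coe]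
    have h1 : normSum ψ R ≤ η⁻¹ * phiSum ψ R := by
      rw [← div_eq_inv_mul, le_div_iff₀ hη, mul_comm]
      exact hR1
    calc c * phiSum ψ R + c * 8 ^ Module.finrank ℚ K * normSum ψ R ^ 2
        ≤ c * phiSum ψ R ^ 2 + c * 8 ^ Module.finrank ℚ K * (η⁻¹ * phiSum ψ R) ^ 2 := by
          gcongr
          exact le_self_pow₀ hR2 two_ne_zero
      _ = D * phiSum ψ R ^ 2 := by rw [hD]; ring
  have hCS := ENNReal.lintegral_mul_le_Lp_mul_Lq (volume.restrict (fundDomain K))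
    Real.HolderConjugate.two_two (measurable_hitsUpTo ψ R).aemeasurable
    (hm.comp (continuous_torusMap K).measurable).aemeasurable
  simp only [Pi.mul_apply, Function.comp_apply] at hCS
  rw [setLIntegral_comp_torusMap (h := fun x => h x ^ (2 : ℝ)) (hm.pow_const _), hVn,
    ENNReal.mul_rpow_of_nonneg _ _ (by norm_num)] at hCS
  rw [lintegral_approxMeasure ψ hm]
  have hp2 : ((phiSum ψ R ^ 2 : ℝ≥0)) ^ (1 / 2 : ℝ) = phiSum ψ R := by
    rw [← NNReal.rpow_natCast, ← NNReal.rpow_mul]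
    norm_num
  have hp0 : phiSum ψ R ≠ 0 := right_ne_zero_of_mul hpos.ne'
  set I := (∫⁻ x, h x ^ (2 : ℝ) ∂torusMeasure K) ^ (1 / 2 : ℝ) with hI
  calc ((c * phiSum ψ R : ℝ≥0) : ℝ≥0∞)⁻¹ *
        ∫⁻ x in fundDomain K, hitsUpTo ψ R x * h (torusMap K x)
      ≤ ((c * phiSum ψ R : ℝ≥0) : ℝ≥0∞)⁻¹ *
        (((D * phiSum ψ R ^ 2 : ℝ≥0) : ℝ≥0∞) ^ (1 / 2 : ℝ) * ((V : ℝ≥0∞) ^ (1 / 2 : ℝ) * I)) := by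
        refine mul_le_mul_right (hCS.trans ?_) _
        gcongr
    _ = (((c * phiSum ψ R)⁻¹ * ((D * phiSum ψ R ^ 2) ^ (1 / 2 : ℝ) *
          V ^ (1 / 2 : ℝ)) : ℝ≥0) : ℝ≥0∞) * I := by
        rw [← ENNReal.coe_rpow_of_nonneg _ (by norm_num),
          ← ENNReal.coe_rpow_of_nonneg _ (by norm_num), ← ENNReal.coe_inv hpos.ne',
          ENNReal.coe_mul, ENNReal.coe_mul (_ ^ _)]
        ring
    _ = _ := by
        rw [NNReal.mul_rpow, NNReal.mul_rpow, hp2]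
        congr 2
        field_simp

/-- The points of a fundamental domain with a bounded number of approximations form a null set. -/
theorem volume_bounded_hits_eq_zero
    (hdiv : ∑' n : IntIdeal K, (eulerPhi n : ℝ≥0∞) * (bigPsi ψ n : ℝ≥0∞) = ∞)
    {η : ℝ≥0} (hη : 0 < η) (hfreq : ∃ᶠ R in atTop, η * normSum ψ R ≤ phiSum ψ R) (M : ℕ) :
    volume ({x | ∑' n, hits ψ n x ≤ M} ∩ fundDomain K) = 0 := by
  have := countable_intIdeal (K := K)
  obtain ⟨φ, hφ, hφR⟩ := extraction_of_frequently_atTop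
    (hfreq.and_eventually ((tendsto_phiSum ψ hdiv).eventually_ge_atTop 1))
  have hlim : Tendsto (fun j => phiSum ψ (φ j)) atTop atTop :=
    (tendsto_phiSum ψ hdiv).comp hφ.tendsto_atTop
  have hνP : ∀ j, IsProbabilityMeasure (approxMeasure ψ (φ j)) := fun j =>
    isProbabilityMeasure_approxMeasure ψ (hφR j).2
  obtain ⟨C, hC⟩ := exists_lintegral_approxMeasure_le ψ hη
  set B : Set (mixedSpace K) := {x | ∑' n, hits ψ n x ≤ M} with hB
  have hBm : MeasurableSet B :=
    measurableSet_le (Measurable.tsum fun n => measurable_hits ψ n) measurable_const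
  have hBper : ∀ (o : 𝓞 K) x, x + mixedEmbedding K o ∈ B ↔ x ∈ B := fun o x => by
    simp only [hB, Set.mem_ofPred_eq, hits_add]
  -- by periodicity, `B` is the full preimage of this subset of the torus
  set B' := torusSection K ⁻¹' B with hB'
  have hB'm : MeasurableSet B' := measurable_torusSection K hBm
  have hpre : torusMap K ⁻¹' B' = B := by
    ext x
    obtain ⟨o, ho⟩ := exists_eq_add_of_torusMap_eq (torusMap_torusSection K (torusMap K x))
    rw [Set.mem_preimage, hB', Set.mem_preimage, ho, hBper]
  have hle : ∀ j, approxMeasure ψ (φ j) B' ≤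
      ((convexBodyLTFactor K * phiSum ψ (φ j) : ℝ≥0) : ℝ≥0∞)⁻¹ *
        (M * volume (fundDomain K)) := by
    intro j
    rw [← lintegral_indicator_one hB'm, lintegral_approxMeasure ψ (measurable_one.indicator hB'm),
      ← setLIntegral_const]
    refine mul_le_mul_right (lintegral_mono fun x => ?_) _
    change _ * B'.indicator 1 (torusMap K x) ≤ (M : ℝ≥0∞)
    have hxB : torusMap K x ∈ B' ↔ x ∈ B := by rw [← Set.mem_preimage, hpre]
    by_cases hx : x ∈ B
    · rw [Set.indicator_of_mem (hxB.2 hx), Pi.one_apply, mul_one]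
      exact (ENNReal.sum_le_tsum _).trans hx
    · rw [Set.indicator_of_notMem (hx ∘ hxB.1), mul_zero]
      exact zero_le
  have hBν : Tendsto (fun j => approxMeasure ψ (φ j) B') atTop (𝓝 0) := by
    refine tendsto_of_tendsto_of_tendsto_of_le_of_le tendsto_const_nhds ?_ (fun _ => zero_le) hle
    have h1 : Tendsto (fun j => ((convexBodyLTFactor K * phiSum ψ (φ j) : ℝ≥0) : ℝ≥0∞)) atTop
        (𝓝 ∞) :=
      ENNReal.tendsto_coe_nhds_top.2
        (hlim.const_mul_atTop (pos_iff_ne_zero.2 (convexBodyLTFactor_ne_zero K)))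
    have h2 := ENNReal.Tendsto.mul_const (tendsto_inv_iff.2 h1)
      (b := M * volume (fundDomain K))
      (Or.inr (ENNReal.mul_ne_top (ENNReal.natCast_ne_top M) volume_fundDomain_ne_top))
    simpa using h2
  have hzero := measure_eq_zero_of_tendsto (torusMeasure K)
    (fun _ => integral_mFourier_torusMeasure) (fun j => approxMeasure ψ (φ j))
    (fun _ => tendsto_integral_mFourier_approxMeasure ψ hη hφR hlim) C
    (fun j => hC (φ j) (hφR j).1 (hφR j).2) hB'm hBν
  rw [torusMeasure, Measure.smul_apply, Measure.map_apply (continuous_torusMap K).measurable hB'm,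
    hpre, smul_eq_mul, mul_eq_zero, Measure.restrict_apply hBm] at hzero
  exact hzero.resolve_left (ENNReal.inv_ne_zero.2 volume_fundDomain_ne_top)

/-- The open boxes that `hits` counts are contained in the closed ones of `IsGoodApprox`. -/
theorem infinite_isGoodApprox_of_tsum_hits_eq_top {x : mixedSpace K}
    (hx : ∑' n, hits ψ n x = ∞) : {γ : K | IsGoodApprox ψ x γ}.Infinite := by
  intro hfin
  have h1 : ∑' n, hits ψ n x =
      ∑' γ : K, (boxAt (fun w => ψ w (den γ)) γ).indicator (1 : mixedSpace K → ℝ≥0∞) x := by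
    rw [← (Equiv.sigmaFiberEquiv (den (K := K))).tsum_eq, ENNReal.tsum_sigma']
    refine tsum_congr fun n => tsum_congr fun γ => ?_
    obtain ⟨γ, rfl⟩ := γ
    rfl
  rw [h1, tsum_eq_sum (s := hfin.toFinset)] at hx
  · refine ENNReal.sum_ne_top.2 (fun γ _ => ?_) hx
    exact ((Set.indicator_le_self' (fun _ _ => zero_le) x).trans_lt ENNReal.one_lt_top).ne
  · intro γ hγ
    refine Set.indicator_of_notMem (fun hmem => hγ ?_) _
    rw [Set.Finite.mem_toFinset]
    rw [boxAt, Set.mem_preimage, mem_convexBodyLT_iff] at hmem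
    exact ⟨fun w => (hmem.1 w).le, fun w => (hmem.2 w).le⟩

/-- Almost every point of the mixed space has infinitely many approximations. -/
theorem ae_infinite_isGoodApprox
    (hdiv : ∑' n : IntIdeal K, (eulerPhi n : ℝ≥0∞) * (bigPsi ψ n : ℝ≥0∞) = ∞)
    {η : ℝ≥0} (hη : 0 < η) (hfreq : ∃ᶠ R in atTop, η * normSum ψ R ≤ phiSum ψ R) :
    ∀ᵐ x : mixedSpace K, {γ : K | IsGoodApprox ψ x γ}.Infinite := by
  have := countable_numberField K
  have : Countable (𝓞 K) := (RingOfIntegers.coe_injective (K := K)).countable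
  have : Countable (mixedEmbedding.integerLattice K) := integerEquiv.symm.injective.countable
  set U : Set (mixedSpace K) := {x | ∑' n, hits ψ n x ≠ ∞} with hU
  have hUF : volume (U ∩ fundDomain K) = 0 := by
    refine measure_mono_null (t := ⋃ M : ℕ, {x | ∑' n, hits ψ n x ≤ M} ∩ fundDomain K) ?_
      (measure_iUnion_null fun M => volume_bounded_hits_eq_zero ψ hdiv hη hfreq M)
    rintro x ⟨hx, hxF⟩
    obtain ⟨M, hM⟩ := ENNReal.exists_nat_gt hx
    exact Set.mem_iUnion.2 ⟨M, hM.le, hxF⟩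
  have hU0 : volume U = 0 := by
    refine (isAddFundamentalDomain_fundDomain K).measure_zero_of_invariant U ?_ hUF
    rintro ⟨_, o, rfl⟩
    ext x
    rw [Set.mem_vadd_set_iff_neg_vadd_mem]
    have e : ∑' n, hits ψ n (-mixedEmbedding K o + x) = ∑' n, hits ψ n x := by
      refine tsum_congr fun n => ?_
      rw [← hits_add ψ n (-mixedEmbedding K o + x) o]
      congr 1
      abel
    change ∑' n, hits ψ n (-mixedEmbedding K o + x) ≠ ∞ ↔ ∑' n, hits ψ n x ≠ ∞
    rw [e]
  rw [ae_iff]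
  refine measure_mono_null (fun x hx => ?_) hU0
  exact fun h => hx (infinite_isGoodApprox_of_tsum_hits_eq_top ψ h)

end Conclusion

end DuffinSchaeffer

open scoped Classical in
theorem mainTheorem1 (K : Type*) [Field K] [NumberField K]
    (D : Set (mixedEmbedding.mixedSpace K))
    (hD : MeasureTheory.IsAddFundamentalDomain (mixedEmbedding.integerLattice K) D
      MeasureTheory.volume)
    (ψ : InfinitePlace K → DuffinSchaeffer.IntIdeal K → ℝ≥0)
    (hdiv : ∑' n : DuffinSchaeffer.IntIdeal K,
      (DuffinSchaeffer.eulerPhi n : ℝ≥0∞) * (DuffinSchaeffer.bigPsi ψ n : ℝ≥0∞) = ∞)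
    (hlimsup : 0 < Filter.limsup (fun R : ℕ =>
      (∑ n ∈ DuffinSchaeffer.idealsUpTo K R,
        (DuffinSchaeffer.eulerPhi n : ℝ≥0∞) * (DuffinSchaeffer.bigPsi ψ n : ℝ≥0∞)) /
      (∑ n ∈ DuffinSchaeffer.idealsUpTo K R,
        (DuffinSchaeffer.idealNorm n : ℝ≥0∞) * (DuffinSchaeffer.bigPsi ψ n : ℝ≥0∞)))
      Filter.atTop)
    (hbound : ∀ (ρ : InfinitePlace K) (n : DuffinSchaeffer.IntIdeal K),
      (ψ ρ n : ℝ) ≤ 1 / (2 * (DuffinSchaeffer.idealNorm n : ℝ) ^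
        ((1 : ℝ) / ((nrRealPlaces K : ℝ) + (nrComplexPlaces K : ℝ))))) :
    MeasureTheory.NullMeasurableSet (DuffinSchaeffer.approxSet D ψ) MeasureTheory.volume ∧
      MeasureTheory.volume (DuffinSchaeffer.approxSet D ψ) = MeasureTheory.volume D := by
  obtain ⟨η, hη, hηlim⟩ := ENNReal.lt_iff_exists_nnreal_btwn.1 hlimsup
  have hfreq : ∃ᶠ R in Filter.atTop,
      η * DuffinSchaeffer.normSum ψ R ≤ DuffinSchaeffer.phiSum ψ R := by
    refine (Filter.frequently_lt_of_lt_limsup (by isBoundedDefault) hηlim).mono fun R hR => ?_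
    have h := ENNReal.mul_le_of_le_div hR.le
    rw [← ENNReal.coe_le_coe, DuffinSchaeffer.normSum, DuffinSchaeffer.phiSum]
    exact_mod_cast h
  have hae := DuffinSchaeffer.ae_infinite_isGoodApprox ψ hdiv (by exact_mod_cast hη) hfreq
  have heq : DuffinSchaeffer.approxSet D ψ =ᵐ[MeasureTheory.volume] D := by
    filter_upwards [hae] with x hx
    exact propext ⟨fun h => h.1, fun h => ⟨h, hx⟩⟩
  exact ⟨hD.nullMeasurableSet.congr heq.symm, MeasureTheory.measure_congr heq⟩
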